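/- Let $N\ge 1$ be an integer and $\hbar>0$. For a Schwartz function $\phi\in\mathcal S(\mathbb R^N)$ (complex valued) with $\|\phi\|_{L^2(\mathbb R^N)}=1$, let $U_\phi:L^2(\mathbb R^N_x)\to L^2(\mathbb R^{2N}_z)$, $z=(x,p)$, be the Wigner wave-packet transform $$U_\phi\psi(x,p)=\Big(\frac1{2\pi\hbar}\Big)^{N/2}e^{\frac{i}{2\hbar}p\cdot x}\int_{\mathbb R^N}e^{-\frac{i}{\hbar}p\cdot x'}\psi(x')\,\phi(x-x')\,dx',$$ and let $\mathcal H_\phi\subset L^2(\mathbb R^{2N})$ be its range, with the inner product of $L^2(\mathbb R^{2N})$. Let $\phi_\hbar(x)=(\pi\hbar)^{-N/4}\exp\big(-\frac{1}{2\hbar}|x|^2\big)$ be the standard Gaussian. (i) A function $\Psi\in L^2(\mathbb R^{2N})$ belongs to $\mathcal H_{\phi_\hbar}$ if and only if $$\Big(\frac{\partial}{\partial x_j}-i\frac{\partial}{\partial p_j}\Big)\Big[\exp\Big(\frac{1}{4\hbar}|z|^2\Big)\Psi(z)\Big]=0\qquad(1\le j\le N)$$ in the sense of distributions on $\mathbb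 R^{2N}$, where $|z|^2=|x|^2+|p|^2$. (ii) For every $\phi\in\mathcal S(\mathbb R^N)$ with $\|\phi\|_{L^2}=1$, the space $\mathcal H_\phi$ is linearly isometric to $\mathcal H_{\phi_\hbar}$, i.e. there is a complex-linear isometry of $\mathcal H_\phi$ onto $\mathcal H_{\phi_\hbar}$. -/

import Mathlib

open MeasureTheory SchwartzMap FourierTransform
open scoped ContDiff ENNReal

noncomputable section

namespace WavePacket

theorem gaussian_smul_decay {E : Type} [NormedAddCommGroup E] [InnerProductSpace ℝ E]
    {a : ℝ} (n : ℕ) : ∀ {F : Type} [NormedAddCommGroup F] [NormedSpace ℝ F] (g : E → F),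
    g.HasTemperateGrowth → ∃ (k : ℕ) (C : ℝ), ∀ x,
      ‖iteratedFDeriv ℝ n (fun x => Real.exp (-a * ‖x‖ ^ 2) • g x) x‖
        ≤ C * (1 + ‖x‖) ^ k * Real.exp (-a * ‖x‖ ^ 2) := by
  induction n with
  | zero =>
    intro F _ _ g hg
    obtain ⟨k, C, h⟩ := hg.2 0
    refine ⟨k, C, fun x => ?_⟩
    have := h x
    simp only [norm_iteratedFDeriv_zero, norm_smul, Real.norm_eq_abs, Real.abs_exp] at this ⊢
    rw [mul_comm]
    gcongr
  | succ n ih =>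
    intro F _ _ g hg
    have hd : fderiv ℝ (fun x : E => Real.exp (-a * ‖x‖ ^ 2) • g x) =
        fun x => Real.exp (-a * ‖x‖ ^ 2) •
          (fderiv ℝ g x + (-(2 * a)) • (innerSL ℝ x).smulRight (g x)) := by
      funext x
      have h1 : HasFDerivAt g (fderiv ℝ g x) x :=
        ((hg.1.differentiable (by simp)) x).hasFDerivAt
      have h2 : HasFDerivAt (fun x : E => Real.exp (-a * ‖x‖ ^ 2)) _ x :=
        (((hasStrictFDerivAt_norm_sq x).hasFDerivAt).const_mul (-a)).exp
      refine (h2.smul h1).fderiv.trans ?_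
      ext v
      simp [smul_smul, smul_add]
      congr 1
      ring
    have hf : (fderiv ℝ g).HasTemperateGrowth := by
      refine ⟨hg.1.fderiv_right (by simp), fun m => ?_⟩
      obtain ⟨k, C, h⟩ := hg.2 (m + 1)
      exact ⟨k, C, fun x => by rw [norm_iteratedFDeriv_fderiv]; exact h x⟩
    have hs : (fun x : E => (innerSL ℝ x).smulRight (g x)).HasTemperateGrowth :=
      (ContinuousLinearMap.smulRightL ℝ E F).bilinear_hasTemperateGrowth
        (innerSL ℝ (E := E)).hasTemperateGrowth hg
    obtain ⟨k, C, h⟩ := ih _ (hf.add ((Function.HasTemperateGrowth.const (-(2 * a))).smul hs))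
    refine ⟨k, C, fun x => ?_⟩
    rw [← norm_iteratedFDeriv_fderiv, hd]
    exact h x

theorem polynomial_mul_gaussian_bounded {a : ℝ} (ha : 0 < a) (m : ℕ) :
    ∃ C, ∀ t : ℝ, 0 ≤ t → (1 + t) ^ m * Real.exp (-a * t ^ 2) ≤ C := by
  refine ⟨m.factorial * Real.exp (1 + (1 / (4 * a))), fun t ht => ?_⟩
  have h1 : (1 + t) ^ m ≤ m.factorial * Real.exp (1 + t) := by
    have := Real.pow_div_factorial_le_exp (1 + t) (by positivity) m
    rw [div_le_iff₀ (by positivity)] at this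
    linarith
  calc _ ≤ m.factorial * Real.exp (1 + t) * Real.exp (-a * t ^ 2) := by gcongr
    _ = m.factorial * Real.exp (1 + t + -a * t ^ 2) := by rw [mul_assoc, ← Real.exp_add]
    _ ≤ _ := by
      refine mul_le_mul_of_nonneg_left (Real.exp_le_exp.mpr ?_) (by positivity)
      have : 1 / (4 * a) - t + a * t ^ 2 = (2 * a * t - 1) ^ 2 / (4 * a) := by field_simp; ring
      have h2 : 0 ≤ (2 * a * t - 1) ^ 2 / (4 * a) := by positivity
      linarith

theorem fourier_L1_L2 {V : Type} [NormedAddCommGroup V] [InnerProductSpace ℝ V]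
    [FiniteDimensional ℝ V] [MeasurableSpace V] [BorelSpace V] {f : V → ℂ}
    (h1 : Integrable f) (h2 : MemLp f 2) :
    ∫⁻ v, ‖𝓕 f v‖ₑ ^ 2 = ∫⁻ v, ‖f v‖ₑ ^ 2 := by
  set g : Lp ℂ 2 (volume : Measure V) := h2.toLp f
  have hcont : Continuous (𝓕 f) := 
    VectorFourier.fourierIntegral_continuous Real.continuous_fourierChar
      (by exact continuous_inner) h1
  have hae : 𝓕 f =ᵐ[volume] (𝓕 g : Lp ℂ 2 (volume : Measure V)) := by
    apply ae_eq_of_integral_contDiff_smul_eq (hcont.locallyIntegrable)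
      ((Lp.memLp _).locallyIntegrable (by norm_num))
    intro u hu hc
    have hg₁ : HasCompactSupport (Complex.ofRealCLM ∘ u) := hc.comp_left rfl
    have hg₂ : ContDiff ℝ ∞ (Complex.ofRealCLM ∘ u) := by fun_prop
    set w : 𝓢(V, ℂ) := hg₁.toSchwartzMap hg₂
    have e1 := DFunLike.congr_fun (Lp.fourier_toTemperedDistribution_eq g) w
    rw [TemperedDistribution.fourier_apply] at e1
    simp only [Lp.toTemperedDistribution_apply] at e1
    have e2 : ∫ x, (𝓕 w) x • g x = ∫ x, 𝓕 (w : V → ℂ) x • f x := by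
      apply integral_congr_ae
      filter_upwards [h2.coeFn_toLp] with x hx
      rw [hx]; rfl
    have e3 : ∫ x, 𝓕 (w : V → ℂ) x • f x = ∫ x, w x • 𝓕 f x := by
      simpa using! (VectorFourier.integral_fourierIntegral_smul_eq_flip (L := innerₗ V)
        Real.continuous_fourierChar continuous_inner w.integrable h1)
    have e4 : ∀ x, w x = (u x : ℂ) := fun x => rfl
    rw [e2, e3] at e1
    simpa [e4] using e1
  have hn : ‖(𝓕 g : Lp ℂ 2 (volume : Measure V))‖ₑ = ‖g‖ₑ := by
    rw [← ofReal_norm, ← ofReal_norm, Lp.norm_fourier_eq]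
  rw [Lp.enorm_def, Lp.enorm_def, ← eLpNorm_congr_ae hae, eLpNorm_congr_ae h2.coeFn_toLp,
    eLpNorm_eq_lintegral_rpow_enorm_toReal (by norm_num) (by norm_num),
    eLpNorm_eq_lintegral_rpow_enorm_toReal (by norm_num) (by norm_num)] at hn
  exact ENNReal.rpow_left_injective (two_ne_zero' ℝ |> inv_ne_zero) (by simpa using hn)

/-- Configuration space `ℝ^N` with its Euclidean structure and Lebesgue measure. -/
abbrev Config (N : ℕ) : Type := EuclideanSpace ℝ (Fin N)

/-- Phase space `ℝ^N × ℝ^N`, with points `z = (x, p)` and Lebesgue measure. -/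
abbrev Phase (N : ℕ) : Type := Config N × Config N

/-- The standard Gaussian `φ_ħ(x) = (πħ)^(-N/4) exp(-|x|²/(2ħ))` as a Schwartz function. -/
def standardGaussian (N : ℕ) (ħ : ℝ) (hħ : 0 < ħ) : 𝓢(Config N, ℂ) where
  toFun x := ((((1 / (Real.pi * ħ)) ^ ((N : ℝ) / 4) *
    Real.exp (-(1 / (2 * ħ)) * ‖x‖ ^ 2) : ℝ)) : ℂ)
  smooth' := by
    have : ContDiff ℝ ∞ fun x : Config N => (1 / (Real.pi * ħ)) ^ ((N : ℝ) / 4) *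
        Real.exp (-(1 / (2 * ħ)) * ‖x‖ ^ 2) :=
      contDiff_const.mul (contDiff_const.mul (contDiff_norm_sq ℝ)).exp
    exact Complex.ofRealCLM.contDiff.comp this
  decay' := by
    intro k n
    obtain ⟨m, C, h⟩ := gaussian_smul_decay (E := Config N) (a := 1 / (2 * ħ)) n
      (fun _ => (((1 / (Real.pi * ħ)) ^ ((N : ℝ) / 4) : ℝ) : ℂ)) (.const _)
    obtain ⟨D, hD⟩ := polynomial_mul_gaussian_bounded
      (a := 1 / (2 * ħ)) (by positivity) (k + m)
    refine ⟨|C| * D, fun x => ?_⟩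
    have he : (fun x : Config N => ((((1 / (Real.pi * ħ)) ^ ((N : ℝ) / 4) *
        Real.exp (-(1 / (2 * ħ)) * ‖x‖ ^ 2) : ℝ)) : ℂ)) =
        fun x => Real.exp (-(1 / (2 * ħ)) * ‖x‖ ^ 2) •
          (((1 / (Real.pi * ħ)) ^ ((N : ℝ) / 4) : ℝ) : ℂ) := by
      funext x
      rw [Complex.real_smul, mul_comm, Complex.ofReal_mul]
    rw [he]
    calc _ ≤ (1 + ‖x‖) ^ k * (|C| * (1 + ‖x‖) ^ m * Real.exp (-(1 / (2 * ħ)) * ‖x‖ ^ 2)) := by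
          refine mul_le_mul (pow_le_pow_left₀ (norm_nonneg _) (by linarith) _) ((h x).trans ?_)
            (norm_nonneg _) (by positivity)
          gcongr
          exact le_abs_self C
      _ = |C| * ((1 + ‖x‖) ^ (k + m) * Real.exp (-(1 / (2 * ħ)) * ‖x‖ ^ 2)) := by ring
      _ ≤ _ := by
          gcongr
          exact hD _ (norm_nonneg x)

/-- The integral defining the Wigner wave-packet transform:
`(2πħ)^(-N/2) exp(i p·x/(2ħ)) ∫ exp(-i p·x'/ħ) ψ(x') φ(x - x') dx'` at `z = (x, p)`. -/
def wavePacketIntegral {N : ℕ} (ħ : ℝ) (φ ψ : Config N → ℂ) (z : Phase N) : ℂ :=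
  (((1 / (2 * Real.pi * ħ)) ^ ((N : ℝ) / 2) : ℝ) : ℂ) *
    Complex.exp (Complex.I / (2 * ħ) * (inner ℝ z.2 z.1 : ℝ)) *
    ∫ y : Config N, Complex.exp (-(Complex.I / ħ) * (inner ℝ z.2 y : ℝ)) * (ψ y * φ (z.1 - y))

theorem integrable_mul_translate {N : ℕ} (φ : 𝓢(Config N, ℂ))
    {ψ : Config N → ℂ} (hψ : MemLp ψ 2) (x : Config N) :
    Integrable (fun y => ψ y * φ (x - y)) :=
  hψ.integrable_mul ((φ.memLp 2).comp_measurePreserving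
    (Measure.measurePreserving_sub_left volume x))

theorem integrable_wavePacket {N : ℕ} (ħ : ℝ) (φ : 𝓢(Config N, ℂ))
    {ψ : Config N → ℂ} (hψ : MemLp ψ 2) (z : Phase N) :
    Integrable (fun y : Config N =>
      Complex.exp (-(Complex.I / ħ) * (inner ℝ z.2 y : ℝ)) * (ψ y * φ (z.1 - y))) := by
  refine (integrable_mul_translate φ hψ z.1).bdd_mul (c := 1)
    (Continuous.aestronglyMeasurable (by fun_prop)) (ae_of_all _ fun y => ?_)
  rw [Complex.norm_exp]
  simp [Complex.div_re]

theorem memLp_mul_translate {N : ℕ} (φ : 𝓢(Config N, ℂ))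
    {ψ : Config N → ℂ} (hψ : MemLp ψ 2) (x : Config N) :
    MemLp (fun y => ψ y * φ (x - y)) 2 := by
  have h := (φ.memLp_top).comp_measurePreserving (Measure.measurePreserving_sub_left volume x)
  exact h.mul' hψ

theorem lintegral_fourier_scaled {N : ℕ} {ħ : ℝ} (hħ : 0 < ħ) {f : Config N → ℂ}
    (h1 : Integrable f) (h2 : MemLp f 2) :
    ∫⁻ p : Config N, ‖∫ y, Complex.exp (-(Complex.I / ħ) * (inner ℝ p y : ℝ)) * f y‖ₑ ^ 2 =
      ENNReal.ofReal |((2 * Real.pi * ħ)⁻¹ ^ N)⁻¹| * ∫⁻ y, ‖f y‖ₑ ^ 2 := by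
  have hc : (2 * Real.pi * ħ)⁻¹ ≠ 0 := by positivity
  have he : ∀ p : Config N, ∫ y, Complex.exp (-(Complex.I / ħ) * (inner ℝ p y : ℝ)) * f y =
      𝓕 f ((2 * Real.pi * ħ)⁻¹ • p) := by
    intro p
    rw [Real.fourier_eq']
    congr 1
    funext y
    rw [smul_eq_mul, real_inner_smul_right, real_inner_comm]
    congr 2
    push_cast
    have : (Real.pi : ℂ) ≠ 0 := by exact_mod_cast Real.pi_ne_zero
    have : (ħ : ℂ) ≠ 0 := by exact_mod_cast hħ.ne'
    field_simp
  have hcont : Continuous (𝓕 f) :=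
    VectorFourier.fourierIntegral_continuous Real.continuous_fourierChar
      (by exact continuous_inner) h1
  simp_rw [he]
  rw [← fourier_L1_L2 h1 h2, ← smul_eq_mul (ENNReal.ofReal _), ← lintegral_smul_measure]
  have hm := Measure.map_addHaar_smul (volume : Measure (Config N)) hc
  rw [finrank_euclideanSpace, Fintype.card_fin] at hm
  rw [← hm, lintegral_map (by fun_prop) (by fun_prop)]

theorem stronglyMeasurable_wavePacketIntegral {N : ℕ} (ħ : ℝ) (φ : 𝓢(Config N, ℂ))
    {ψ : Config N → ℂ} (hψ : StronglyMeasurable ψ) :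
    StronglyMeasurable (wavePacketIntegral ħ φ ψ) := by
  refine StronglyMeasurable.mul (Continuous.stronglyMeasurable (by fun_prop)) ?_
  refine StronglyMeasurable.integral_prod_right' (f := fun q : Phase N × Config N =>
    Complex.exp (-(Complex.I / ħ) * (inner ℝ q.1.2 q.2 : ℝ)) * (ψ q.2 * φ (q.1.1 - q.2))) ?_
  refine StronglyMeasurable.mul (Continuous.stronglyMeasurable (by fun_prop)) ?_
  refine StronglyMeasurable.mul (hψ.comp_measurable measurable_snd) ?_
  exact Continuous.stronglyMeasurable (by fun_prop)

theorem memLp_wavePacketIntegral {N : ℕ} {ħ : ℝ} (hħ : 0 < ħ) (φ : 𝓢(Config N, ℂ))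
    (ψ : Lp ℂ 2 (volume : Measure (Config N))) :
    MemLp (wavePacketIntegral ħ φ ψ) 2 (volume : Measure (Phase N)) := by
  have hsm := Lp.stronglyMeasurable ψ
  have hψ := Lp.memLp ψ
  have hU := stronglyMeasurable_wavePacketIntegral ħ φ hsm
  refine ⟨hU.aestronglyMeasurable, ?_⟩
  rw [eLpNorm_lt_top_iff_lintegral_rpow_enorm_lt_top (by norm_num) (by norm_num)]
  simp only [ENNReal.toReal_ofNat, ENNReal.rpow_ofNat]
  set c : ℝ := (1 / (2 * Real.pi * ħ)) ^ ((N : ℝ) / 2) with hcdef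
  set d : ℝ≥0∞ := ENNReal.ofReal |((2 * Real.pi * ħ)⁻¹ ^ N)⁻¹| with hd
  have hpt : ∀ z : Phase N, ‖wavePacketIntegral ħ φ ψ z‖ₑ ^ 2 = ‖(c : ℂ)‖ₑ ^ 2 *
      ‖∫ y : Config N, Complex.exp (-(Complex.I / ħ) * (inner ℝ z.2 y : ℝ)) *
        (ψ y * φ (z.1 - y))‖ₑ ^ 2 := by
    intro z
    have h1 : ‖Complex.exp (Complex.I / (2 * ħ) * (inner ℝ z.2 z.1 : ℝ))‖ₑ = 1 := by
      rw [← ofReal_norm, Complex.norm_exp]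
      simp [Complex.div_re]
    rw [wavePacketIntegral, enorm_mul, enorm_mul, h1, mul_one, mul_pow]
  have hsq : ∀ {V : Type} [MeasurableSpace V] {μ : Measure V} {f : V → ℂ}, MemLp f 2 μ →
      ∫⁻ v, ‖f v‖ₑ ^ 2 ∂μ < ⊤ := by
    intro V _ μ f hf
    have := (eLpNorm_lt_top_iff_lintegral_rpow_enorm_lt_top (by norm_num) (by norm_num)).1 hf.2
    simpa using this
  have hψm : Measurable fun y => ‖ψ y‖ₑ ^ 2 := (hsm.measurable.enorm).pow_const 2
  have hφm : Measurable fun q : Config N × Config N => ‖φ (q.1 - q.2)‖ₑ ^ 2 :=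
    ((φ.continuous.comp (continuous_fst.sub continuous_snd)).measurable.enorm).pow_const 2
  rw [Measure.volume_eq_prod, lintegral_prod _ (hU.measurable.enorm.pow_const 2).aemeasurable]
  have hin : ∀ x : Config N, ∫⁻ p : Config N, ‖wavePacketIntegral ħ φ ψ (x, p)‖ₑ ^ 2 =
      ‖(c : ℂ)‖ₑ ^ 2 * (d * ∫⁻ y, ‖ψ y‖ₑ ^ 2 * ‖φ (x - y)‖ₑ ^ 2) := by
    intro x
    simp_rw [hpt]
    rw [lintegral_const_mul' _ _ (by simp)]
    rw [lintegral_fourier_scaled hħ (integrable_mul_translate φ hψ x)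
      (memLp_mul_translate φ hψ x)]
    simp_rw [enorm_mul, mul_pow]
    rfl
  simp_rw [hin]
  rw [lintegral_const_mul' _ _ (by simp), lintegral_const_mul' _ _ (by simp [hd])]
  refine ENNReal.mul_lt_top (by simp) (ENNReal.mul_lt_top (by simp [hd]) ?_)
  rw [lintegral_lintegral_swap
    (((hψm.comp measurable_snd).mul hφm).aemeasurable)]
  have hy : ∀ y : Config N, ∫⁻ x, ‖ψ y‖ₑ ^ 2 * ‖φ (x - y)‖ₑ ^ 2 =
      ‖ψ y‖ₑ ^ 2 * ∫⁻ x, ‖φ x‖ₑ ^ 2 := by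
    intro y
    rw [lintegral_const_mul' _ _ (by simp),
      lintegral_sub_right_eq_self (fun x => ‖φ x‖ₑ ^ 2) y]
  simp_rw [hy]
  rw [lintegral_mul_const _ hψm]
  exact ENNReal.mul_lt_top (hsq hψ) (hsq (φ.memLp 2))

/-- The Wigner wave-packet transform `U_φ : L²(ℝ^N) → L²(ℝ^{2N})` with window `φ`. -/
def wavePacketTransform {N : ℕ} (ħ : ℝ) (hħ : 0 < ħ) (φ : 𝓢(Config N, ℂ)) :
    Lp ℂ 2 (volume : Measure (Config N)) →ₗ[ℂ] Lp ℂ 2 (volume : Measure (Phase N)) where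
  toFun ψ := (memLp_wavePacketIntegral hħ φ ψ).toLp (wavePacketIntegral ħ φ ψ)
  map_add' ψ₁ ψ₂ := by
    rw [← MemLp.toLp_add]
    apply MemLp.toLp_congr
    refine ae_of_all _ fun z => ?_
    simp only [wavePacketIntegral, Pi.add_apply]
    rw [← mul_add, ← integral_add (integrable_wavePacket ħ φ (Lp.memLp ψ₁) z)
      (integrable_wavePacket ħ φ (Lp.memLp ψ₂) z)]
    congr 1
    apply integral_congr_ae
    filter_upwards [Lp.coeFn_add ψ₁ ψ₂] with y hy
    rw [hy, Pi.add_apply]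
    ring
  map_smul' a ψ := by
    rw [RingHom.id_apply, ← MemLp.toLp_const_smul]
    apply MemLp.toLp_congr
    refine ae_of_all _ fun z => ?_
    simp only [wavePacketIntegral, Pi.smul_apply, smul_eq_mul]
    rw [mul_left_comm a, ← integral_const_mul a]
    congr 1
    apply integral_congr_ae
    filter_upwards [Lp.coeFn_smul a ψ] with y hy
    rw [hy, Pi.smul_apply, smul_eq_mul]
    ring

/-- The range `H_φ` of `U_φ`, with the inner product of `L²(ℝ^{2N})`. -/
def wavePacketRange {N : ℕ} (ħ : ℝ) (hħ : 0 < ħ) (φ : 𝓢(Config N, ℂ)) :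
    Submodule ℂ (Lp ℂ 2 (volume : Measure (Phase N))) :=
  LinearMap.range (wavePacketTransform ħ hħ φ)

/-- `(∂/∂x_j - i ∂/∂p_j) F = 0` on phase space in the sense of distributions, for a locally
integrable function `F`: `-∫ F (∂χ/∂x_j - i ∂χ/∂p_j) dz = 0` for all test functions `χ`. -/
def SatisfiesCauchyRiemann {N : ℕ} (j : Fin N) (F : Phase N → ℂ) : Prop :=
  LocallyIntegrable F ∧
    ∀ χ : Phase N → ℂ, ContDiff ℝ ∞ χ → HasCompactSupport χ →
      -∫ z, F z * (fderiv ℝ χ z (EuclideanSpace.single j 1, 0) -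
        Complex.I * fderiv ℝ χ z (0, EuclideanSpace.single j 1)) = 0

end WavePacket

end

/-!
Plancherel in the momentum variable gives `‖U_φ ψ‖ = ‖ψ‖ ‖φ‖` for every window `φ`, so all the
ranges `H_φ` with `‖φ‖ = 1` are isometric to `L²(ℝ^N)`, which is (ii), and they are closed.

For (i), with `a = 1/(4ħ)`, let `K` be the space of the `Ψ` in `L²` for which `exp (a|z|²) Ψ`
satisfies the Cauchy-Riemann equations; it is closed too. Both `H_{φ_ħ}` and `K` contain the
coherent states `exp (-a|z|² + A(x - ip))` with `A` a complex linear form, which are the images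
under `U_{φ_ħ}` of Gaussians, up to a constant. It remains to see that `0` is the only vector of
either space orthogonal to all coherent states, as then both spaces are the closed span of these
states. In `H_{φ_ħ}` this is the totality of the Gaussians `exp (-2a|y|² + L y)` in `L²(ℝ^N)`, that
is, uniqueness for the Fourier transform. For `Ψ` in `K`, put `y(t) = ∫ Ψ exp (-a|z|² + B(x + ip) +
t A(x - ip)) dz`. Testing the Cauchy-Riemann equations against Gaussians shows that `y' = c y` with
a constant `c`, and orthogonality to the coherent states says that `y(0) = 0`. Hence `y(1) = 0` for
all `A` and `B`, and uniqueness for the Fourier transform on phase space gives `Ψ = 0`.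
-/

noncomputable section

namespace WavePacket

section FourierUniqueness

variable {V : Type*} [NormedAddCommGroup V] [InnerProductSpace ℝ V] [FiniteDimensional ℝ V]
  [MeasurableSpace V] [BorelSpace V] {f : V → ℂ}

theorem ae_eq_zero_of_fourier_eq_zero (hf : Integrable f) (h : 𝓕 f = 0) : f =ᵐ[volume] 0 := by
  refine ae_eq_zero_of_integral_contDiff_smul_eq_zero hf.locallyIntegrable fun u hu hc => ?_
  have hc' : HasCompactSupport (Complex.ofRealCLM ∘ u) := hc.comp_left rfl
  let w : 𝓢(V, ℂ) := hc'.toSchwartzMap (by fun_prop)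
  let w' : 𝓢(V, ℂ) := 𝓕⁻ w
  have parseval : ∫ v, 𝓕 (⇑w') v • f v = ∫ v, w' v • 𝓕 f v := by
    simpa using! VectorFourier.integral_fourierIntegral_smul_eq_flip (L := innerₗ V)
      Real.continuous_fourierChar continuous_inner w'.integrable hf
  have inversion : 𝓕 (⇑w') = w := by
    rw [← SchwartzMap.fourier_coe, FourierTransform.fourier_fourierInv_eq]
  rw [inversion, h] at parseval
  simpa using! parseval

theorem ae_eq_zero_of_integral_mul_cexp_inner_eq_zero (hf : Integrable f)
    (h : ∀ ξ : V, ∫ v, f v * Complex.exp (-(Complex.I * (inner ℝ ξ v : ℝ))) = 0) :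
    f =ᵐ[volume] 0 := by
  refine ae_eq_zero_of_fourier_eq_zero hf (funext fun ξ => ?_)
  rw [Real.fourier_eq', Pi.zero_apply, ← h ((2 * Real.pi) • ξ)]
  congr 1 with v
  rw [smul_eq_mul, mul_comm, real_inner_smul_left, real_inner_comm]
  congr 2
  push_cast
  ring

end FourierUniqueness

section Gaussian

/-- The Gaussian `exp (-a‖v‖² + L v)` centred by a complex-valued real-linear form `L`. -/
def gaussianExp {E : Type*} [NormedAddCommGroup E] [NormedSpace ℝ E] (a : ℝ) (L : E →L[ℝ] ℂ)
    (v : E) : ℂ :=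
  Complex.exp (-(a : ℂ) * ((‖v‖ ^ 2 : ℝ) : ℂ) + L v)

section Normed

variable {E : Type*} [NormedAddCommGroup E] [NormedSpace ℝ E]

@[fun_prop]
theorem continuous_gaussianExp (a : ℝ) (L : E →L[ℝ] ℂ) : Continuous (gaussianExp a L) := by
  unfold gaussianExp
  fun_prop

theorem norm_gaussianExp (a : ℝ) (L : E →L[ℝ] ℂ) (v : E) :
    ‖gaussianExp a L v‖ = Real.exp (-a * ‖v‖ ^ 2 + (L v).re) := by
  rw [gaussianExp, Complex.norm_exp]
  norm_cast

theorem hasDerivAt_gaussianExp_add_smul (a : ℝ) (L A : E →L[ℝ] ℂ) (v : E) (t : ℝ) :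
    HasDerivAt (fun s : ℝ => gaussianExp a (L + s • A) v)
      (A v * gaussianExp a (L + t • A) v) t := by
  have exponent : HasDerivAt (fun s : ℝ => -(a : ℂ) * ((‖v‖ ^ 2 : ℝ) : ℂ) + (L v + s • A v))
      (A v) t := by
    simpa using (((hasDerivAt_id t).smul_const (A v)).const_add (L v)).const_add
      (-(a : ℂ) * ((‖v‖ ^ 2 : ℝ) : ℂ))
  simpa [gaussianExp, mul_comm] using exponent.cexp

theorem one_add_norm_mul_norm_gaussianExp_le {a C : ℝ} (ha : 0 < a) {L : E →L[ℝ] ℂ}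
    (hL : ‖L‖ ≤ C) (v : E) :
    (1 + ‖v‖) * ‖gaussianExp a L v‖ ≤
      Real.exp ((C + 1) ^ 2 / (2 * a)) * Real.exp (-(a / 2) * ‖v‖ ^ 2) := by
  have linear : (L v).re ≤ C * ‖v‖ := (Complex.re_le_norm _).trans (L.le_of_opNorm_le hL v)
  have square : (C + 1) ^ 2 / (2 * a) - (C + 1) * ‖v‖ + a / 2 * ‖v‖ ^ 2 =
      (a * ‖v‖ - (C + 1)) ^ 2 / (2 * a) := by
    field_simp
    ring
  have square_nonneg : 0 ≤ (a * ‖v‖ - (C + 1)) ^ 2 / (2 * a) := by positivity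
  calc (1 + ‖v‖) * ‖gaussianExp a L v‖
      ≤ Real.exp ‖v‖ * Real.exp (-a * ‖v‖ ^ 2 + C * ‖v‖) := by
        rw [norm_gaussianExp, add_comm 1]
        gcongr
        exact Real.add_one_le_exp _
    _ ≤ _ := by
        rw [← Real.exp_add, ← Real.exp_add]
        exact Real.exp_le_exp.2 (by linarith)

theorem norm_mul_gaussianExp_le {a C K : ℝ} (ha : 0 < a) {L : E →L[ℝ] ℂ} {v : E} {w : ℂ}
    (hw : ‖w‖ ≤ K * (1 + ‖v‖)) (hL : ‖L‖ ≤ C) :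
    ‖w * gaussianExp a L v‖ ≤
      K * Real.exp ((C + 1) ^ 2 / (2 * a)) * Real.exp (-(a / 2) * ‖v‖ ^ 2) := by
  have hK : 0 ≤ K := nonneg_of_mul_nonneg_left ((norm_nonneg _).trans hw) (by positivity)
  calc ‖w * gaussianExp a L v‖ ≤ K * ((1 + ‖v‖) * ‖gaussianExp a L v‖) := by
        rw [norm_mul, ← mul_assoc]
        gcongr
    _ ≤ _ := by
        rw [mul_assoc K]
        exact mul_le_mul_of_nonneg_left (one_add_norm_mul_norm_gaussianExp_le ha hL v) hK

theorem norm_clm_apply_le_mul_one_add_norm (A : E →L[ℝ] ℂ) (v : E) :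
    ‖A v‖ ≤ ‖A‖ * (1 + ‖v‖) :=
  (A.le_opNorm v).trans (by gcongr; linarith)

end Normed

variable {V : Type*} [NormedAddCommGroup V] [InnerProductSpace ℝ V] [FiniteDimensional ℝ V]
  [MeasurableSpace V] [BorelSpace V] {a : ℝ}

theorem integrable_rexp_neg_mul_sq_norm (ha : 0 < a) :
    Integrable fun v : V => Real.exp (-a * ‖v‖ ^ 2) := by
  refine (GaussianFourier.integrable_cexp_neg_mul_sq_norm_add (V := V)
    (b := (a : ℂ)) (by simpa using ha) 0 0).norm.congr (ae_of_all _ fun v => ?_)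
  simp only [inner_zero_left, Complex.ofReal_zero, mul_zero, add_zero]
  rw [Complex.norm_exp]
  norm_cast

theorem memLp_rexp_neg_mul_sq_norm (ha : 0 < a) :
    MemLp (fun v : V => Real.exp (-a * ‖v‖ ^ 2)) 2 := by
  rw [memLp_two_iff_integrable_sq (by fun_prop)]
  refine (integrable_rexp_neg_mul_sq_norm (V := V) (a := 2 * a) (by positivity)).congr
    (ae_of_all _ fun v => ?_)
  simp only [← Real.exp_nat_mul]
  congr 1
  push_cast
  ring

theorem memLp_mul_gaussianExp (ha : 0 < a) {f : V → ℂ} (hf : Continuous f) {K : ℝ}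
    (hK : ∀ v, ‖f v‖ ≤ K * (1 + ‖v‖)) (L : V →L[ℝ] ℂ) :
    MemLp (fun v => f v * gaussianExp a L v) 2 :=
  ((memLp_rexp_neg_mul_sq_norm (half_pos ha)).const_mul
    (K * Real.exp ((‖L‖ + 1) ^ 2 / (2 * a)))).mono' (by fun_prop)
    (ae_of_all _ fun v => norm_mul_gaussianExp_le ha (hK v) le_rfl)

theorem memLp_gaussianExp (ha : 0 < a) (L : V →L[ℝ] ℂ) : MemLp (gaussianExp a L) 2 := by
  simpa using memLp_mul_gaussianExp ha continuous_const (K := 1) (f := fun _ => 1) (by simp) L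

theorem memLp_clm_mul_gaussianExp (ha : 0 < a) (A L : V →L[ℝ] ℂ) :
    MemLp (fun v => A v * gaussianExp a L v) 2 :=
  memLp_mul_gaussianExp ha A.continuous (norm_clm_apply_le_mul_one_add_norm A) L

theorem hasDerivAt_integral_mul_gaussianExp (ha : 0 < a) {f : V → ℂ} (hf : MemLp f 2)
    (L A : V →L[ℝ] ℂ) (t : ℝ) :
    HasDerivAt (fun s : ℝ => ∫ v, f v * gaussianExp a (L + s • A) v)
      (∫ v, f v * (A v * gaussianExp a (L + t • A) v)) t := by
  set C := ‖L‖ + (|t| + 1) * ‖A‖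
  have norm_le : ∀ s ∈ Metric.ball t 1, ‖L + s • A‖ ≤ C := by
    intro s hs
    have : |s| ≤ |t| + 1 := by
      have := abs_sub_abs_le_abs_sub s t
      rw [Metric.mem_ball, Real.dist_eq] at hs
      linarith
    calc ‖L + s • A‖ ≤ ‖L‖ + |s| * ‖A‖ := by
          rw [← Real.norm_eq_abs, ← norm_smul]
          exact norm_add_le _ _
      _ ≤ ‖L‖ + (|t| + 1) * ‖A‖ := by gcongr
  refine (hasDerivAt_integral_of_dominated_loc_of_deriv_le (Metric.ball_mem_nhds t one_pos)
    (bound := fun v => ‖f v‖ * (‖A‖ * Real.exp ((C + 1) ^ 2 / (2 * a)) *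
      Real.exp (-(a / 2) * ‖v‖ ^ 2)))
    (.of_forall fun s => hf.1.mul (continuous_gaussianExp a _).aestronglyMeasurable)
    (hf.integrable_mul (memLp_gaussianExp ha _))
    (hf.1.mul (memLp_clm_mul_gaussianExp ha A _).1)
    (ae_of_all _ fun v s hs => ?_)
    (hf.norm.integrable_mul ((memLp_rexp_neg_mul_sq_norm (half_pos ha)).const_mul _))
    (ae_of_all _ fun v s _ => (hasDerivAt_gaussianExp_add_smul a L A v s).const_mul (f v))).2
  rw [norm_mul]
  gcongr
  exact norm_mul_gaussianExp_le ha (norm_clm_apply_le_mul_one_add_norm A v) (norm_le s hs)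

theorem ae_eq_zero_of_integral_mul_gaussianExp_eq_zero (ha : 0 < a) {f : V → ℂ} (hf : MemLp f 2)
    (h : ∀ L : V →L[ℝ] ℂ, ∫ v, f v * gaussianExp a L v = 0) : f =ᵐ[volume] 0 := by
  have prod_zero : (fun v => f v * gaussianExp a 0 v) =ᵐ[volume] 0 := by
    refine ae_eq_zero_of_integral_mul_cexp_inner_eq_zero
      (hf.integrable_mul (memLp_gaussianExp ha 0)) fun ξ => ?_
    rw [← h (-Complex.I • (Complex.ofRealCLM ∘L innerSL ℝ ξ))]
    congr 1 with v
    simp [gaussianExp, mul_assoc, Complex.exp_add]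
  filter_upwards [prod_zero] with v hv
  exact (mul_eq_zero.1 hv).resolve_right (Complex.exp_ne_zero _)

end Gaussian

section ProductGaussian

section Normed

variable {E F : Type*} [NormedAddCommGroup E] [NormedSpace ℝ E] [NormedAddCommGroup F]
  [NormedSpace ℝ F]

/-- The Gaussian `exp (-a(‖x‖² + ‖p‖²) + M (x, p))`. It differs from `gaussianExp` on the product
type, whose norm is the maximum of the norms of the components. -/
def prodGaussianExp (a : ℝ) (M : E × F →L[ℝ] ℂ) (z : E × F) : ℂ :=
  Complex.exp (-(a : ℂ) * ((‖z.1‖ ^ 2 + ‖z.2‖ ^ 2 : ℝ) : ℂ) + M z)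

theorem prodGaussianExp_mul (a b : ℝ) (L M : E × F →L[ℝ] ℂ) (z : E × F) :
    prodGaussianExp a L z * prodGaussianExp b M z = prodGaussianExp (a + b) (L + M) z := by
  simp only [prodGaussianExp, ← Complex.exp_add, add_apply]
  congr 1
  push_cast
  ring

@[fun_prop]
theorem continuous_prodGaussianExp (a : ℝ) (M : E × F →L[ℝ] ℂ) :
    Continuous (prodGaussianExp a M) := by
  unfold prodGaussianExp
  fun_prop

end Normed

variable {V W : Type*} [NormedAddCommGroup V] [InnerProductSpace ℝ V] [NormedAddCommGroup W]
  [InnerProductSpace ℝ W]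

theorem contDiff_prodGaussianExp (a : ℝ) (M : V × W →L[ℝ] ℂ) :
    ContDiff ℝ ∞ (prodGaussianExp a M) := by
  have hsq : ContDiff ℝ ∞ fun z : V × W => ((‖z.1‖ ^ 2 + ‖z.2‖ ^ 2 : ℝ) : ℂ) :=
    Complex.ofRealCLM.contDiff.comp ((contDiff_fst.norm_sq ℝ).add (contDiff_snd.norm_sq ℝ))
  exact ((contDiff_const.mul hsq).add M.contDiff).cexp

/-- A form on `V × W`, viewed on the `ℓ²` product `WithLp 2 (V × W)`, which unlike `V × W` is an
inner product space. -/
def withLpForm (M : V × W →L[ℝ] ℂ) : WithLp 2 (V × W) →L[ℝ] ℂ :=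
  M ∘L (WithLp.prodContinuousLinearEquiv 2 ℝ V W : WithLp 2 (V × W) →L[ℝ] V × W)

theorem prodGaussianExp_eq_gaussianExp_comp_toLp (a : ℝ) (M : V × W →L[ℝ] ℂ) :
    prodGaussianExp a M = gaussianExp a (withLpForm M) ∘ WithLp.toLp 2 := by
  ext z
  simp [prodGaussianExp, gaussianExp, withLpForm, WithLp.prod_norm_sq_eq_of_L2]

variable [FiniteDimensional ℝ V] [MeasurableSpace V] [BorelSpace V] [FiniteDimensional ℝ W]
  [MeasurableSpace W] [BorelSpace W] {a : ℝ}

theorem integral_withLp_ofLp (f : V × W → ℂ) : ∫ v : WithLp 2 (V × W), f v.ofLp = ∫ z, f z :=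
  (WithLp.volume_preserving_ofLp V W).integral_comp
    (MeasurableEquiv.toLp 2 (V × W)).symm.measurableEmbedding f

theorem memLp_prodGaussianExp (ha : 0 < a) (M : V × W →L[ℝ] ℂ) :
    MemLp (prodGaussianExp a M) 2 := by
  rw [prodGaussianExp_eq_gaussianExp_comp_toLp]
  exact (memLp_gaussianExp ha _).comp_measurePreserving (WithLp.volume_preserving_toLp V W)

theorem memLp_clm_mul_prodGaussianExp (ha : 0 < a) (A M : V × W →L[ℝ] ℂ) :
    MemLp (fun z => A z * prodGaussianExp a M z) 2 := by
  rw [prodGaussianExp_eq_gaussianExp_comp_toLp]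
  exact (memLp_clm_mul_gaussianExp ha (withLpForm A) _).comp_measurePreserving
    (WithLp.volume_preserving_toLp V W)

theorem hasDerivAt_integral_mul_prodGaussianExp (ha : 0 < a) {f : V × W → ℂ} (hf : MemLp f 2)
    (L A : V × W →L[ℝ] ℂ) (t : ℝ) :
    HasDerivAt (fun s : ℝ => ∫ z, f z * prodGaussianExp a (L + s • A) z)
      (∫ z, f z * (A z * prodGaussianExp a (L + t • A) z)) t := by
  simp_rw [← integral_withLp_ofLp, prodGaussianExp_eq_gaussianExp_comp_toLp]
  exact hasDerivAt_integral_mul_gaussianExp ha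
    (hf.comp_measurePreserving (WithLp.volume_preserving_ofLp V W)) (withLpForm L) (withLpForm A) t

theorem ae_eq_zero_of_integral_mul_prodGaussianExp_eq_zero (ha : 0 < a) {f : V × W → ℂ}
    (hf : MemLp f 2) (h : ∀ M : V × W →L[ℝ] ℂ, ∫ z, f z * prodGaussianExp a M z = 0) :
    f =ᵐ[volume] 0 := by
  have lifted_zero : (fun v : WithLp 2 (V × W) => f v.ofLp) =ᵐ[volume] 0 := by
    refine ae_eq_zero_of_integral_mul_gaussianExp_eq_zero ha
      (hf.comp_measurePreserving (WithLp.volume_preserving_ofLp V W)) fun L => ?_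
    rw [← h (L ∘L (WithLp.prodContinuousLinearEquiv 2 ℝ V W).symm), ← integral_withLp_ofLp]
    congr 1 with v
    rw [prodGaussianExp_eq_gaussianExp_comp_toLp]
    rfl
  exact (WithLp.volume_preserving_toLp V W).quasiMeasurePreserving.ae_eq_comp lifted_zero

end ProductGaussian

section ComplexForms

variable {E : Type*} [NormedAddCommGroup E] [NormedSpace ℝ E]

/-- The form `(x, p) ↦ L x + i L p`; for `E = ℝ^N` it is complex linear in `x + ip`. -/
def holomorphicForm (L : E →L[ℝ] ℂ) : E × E →L[ℝ] ℂ :=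
  L ∘L ContinuousLinearMap.fst ℝ E E + Complex.I • (L ∘L ContinuousLinearMap.snd ℝ E E)

/-- The form `(x, p) ↦ L x - i L p`; for `E = ℝ^N` it is complex linear in `x - ip`. -/
def antiholomorphicForm (L : E →L[ℝ] ℂ) : E × E →L[ℝ] ℂ :=
  L ∘L ContinuousLinearMap.fst ℝ E E - Complex.I • (L ∘L ContinuousLinearMap.snd ℝ E E)

theorem holomorphicForm_apply (L : E →L[ℝ] ℂ) (z : E × E) :
    holomorphicForm L z = L z.1 + Complex.I * L z.2 := rfl

theorem antiholomorphicForm_apply (L : E →L[ℝ] ℂ) (z : E × E) :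
    antiholomorphicForm L z = L z.1 - Complex.I * L z.2 := rfl

theorem exists_eq_holomorphicForm_add_antiholomorphicForm (M : E × E →L[ℝ] ℂ) :
    ∃ B A : E →L[ℝ] ℂ, M = holomorphicForm B + antiholomorphicForm A := by
  let Mx := M ∘L ContinuousLinearMap.inl ℝ E E
  let Mp := M ∘L ContinuousLinearMap.inr ℝ E E
  refine ⟨(1 / 2 : ℂ) • (Mx - Complex.I • Mp), (1 / 2 : ℂ) • (Mx + Complex.I • Mp), ?_⟩
  refine ContinuousLinearMap.ext fun z => ?_
  have split : M z = Mx z.1 + Mp z.2 := by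
    simp only [Mx, Mp, ContinuousLinearMap.comp_apply, ContinuousLinearMap.inl_apply,
      ContinuousLinearMap.inr_apply, ← map_add, Prod.mk_add_mk, add_zero, zero_add]
  simp only [split, holomorphicForm_apply, antiholomorphicForm_apply, add_apply, sub_apply,
    smul_apply, smul_eq_mul]
  linear_combination Mp z.2 * Complex.I_sq

theorem conj_prodGaussianExp_antiholomorphicForm (a : ℝ) (L : E →L[ℝ] ℂ) (z : E × E) :
    starRingEnd ℂ (prodGaussianExp a (antiholomorphicForm L) z) =
      prodGaussianExp a (holomorphicForm ((Complex.conjCLE : ℂ →L[ℝ] ℂ) ∘L L)) z := by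
  rw [prodGaussianExp, prodGaussianExp, ← Complex.exp_conj]
  congr 1
  simp [antiholomorphicForm_apply, holomorphicForm_apply]

theorem apply_eq_sum_mul_single {N : ℕ} (L : Config N →L[ℝ] ℂ) (x : Config N) :
    L x = ∑ j, L (EuclideanSpace.single j 1) * (x j : ℂ) := by
  conv_lhs => rw [← (EuclideanSpace.basisFun (Fin N) ℝ).sum_repr x]
  simp [mul_comm]

end ComplexForms

theorem fderiv_prodGaussianExp_apply {V W : Type*} [NormedAddCommGroup V] [InnerProductSpace ℝ V]
    [NormedAddCommGroup W] [InnerProductSpace ℝ W] (a : ℝ) (M : V × W →L[ℝ] ℂ) (z h : V × W) :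
    fderiv ℝ (prodGaussianExp a M) z h =
      (M h - 2 * a * ((inner ℝ z.1 h.1 + inner ℝ z.2 h.2 : ℝ) : ℂ)) * prodGaussianExp a M z := by
  have hsq : HasFDerivAt (fun z : V × W => ((‖z.1‖ ^ 2 + ‖z.2‖ ^ 2 : ℝ) : ℂ)) _ z :=
    Complex.ofRealCLM.hasFDerivAt.comp z
      ((hasFDerivAt_fst (𝕜 := ℝ) (p := z)).norm_sq.add (hasFDerivAt_snd (𝕜 := ℝ) (p := z)).norm_sq)
  have hG : HasFDerivAt (prodGaussianExp a M) _ z :=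
    ((hsq.const_mul (-(a : ℂ))).add M.hasFDerivAt).cexp
  rw [hG.fderiv]
  simp only [Complex.ofReal_add, Complex.ofReal_pow, neg_mul, Pi.add_apply,
    ContinuousLinearMap.comp_add, ContinuousLinearMap.comp_smul, smul_add, neg_smul,
    Complex.coe_smul, smul_neg, add_apply, neg_apply, smul_apply, ContinuousLinearMap.comp_apply,
    ContinuousLinearMap.coe_fst', coe_innerSL_apply, Complex.ofRealCLM_apply, nsmul_eq_mul,
    Nat.cast_ofNat, Complex.real_smul, smul_eq_mul, ContinuousLinearMap.coe_snd', prodGaussianExp]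
  ring

section CauchyRiemann

variable {N : ℕ} {j : Fin N} {f g u F : Phase N → ℂ}

/-- The derivative `(∂/∂x_j - i ∂/∂p_j) f` at the point `z`. -/
def cauchyRiemannDeriv (j : Fin N) (f : Phase N → ℂ) (z : Phase N) : ℂ :=
  fderiv ℝ f z (EuclideanSpace.single j 1, 0) -
    Complex.I * fderiv ℝ f z (0, EuclideanSpace.single j 1)

/-- The conjugate coordinate `x_j - i p_j`, as a form on phase space. -/
def conjCoord (j : Fin N) : Phase N →L[ℝ] ℂ :=
  antiholomorphicForm (Complex.ofRealCLM ∘L EuclideanSpace.proj j)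

theorem conjCoord_apply (j : Fin N) (z : Phase N) :
    conjCoord j z = (z.1 j : ℂ) - Complex.I * (z.2 j : ℂ) := rfl

theorem antiholomorphicForm_eq_sum_conjCoord (L : Config N →L[ℝ] ℂ) (z : Phase N) :
    antiholomorphicForm L z = ∑ j, L (EuclideanSpace.single j 1) * conjCoord j z := by
  rw [antiholomorphicForm_apply, apply_eq_sum_mul_single L z.1, apply_eq_sum_mul_single L z.2,
    Finset.mul_sum, ← Finset.sum_sub_distrib]
  refine Finset.sum_congr rfl fun j _ => ?_
  rw [conjCoord_apply]
  ring

theorem cauchyRiemannDeriv_mul {z : Phase N} (hf : DifferentiableAt ℝ f z)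
    (hg : DifferentiableAt ℝ g z) :
    cauchyRiemannDeriv j (fun z => f z * g z) z =
      f z * cauchyRiemannDeriv j g z + cauchyRiemannDeriv j f z * g z := by
  simp only [cauchyRiemannDeriv, fderiv_fun_mul hf hg, add_apply, smul_apply, smul_eq_mul]
  ring

theorem cauchyRiemannDeriv_comp_smul (c : ℝ) (z : Phase N) :
    cauchyRiemannDeriv j (fun z => f (c • z)) z = c * cauchyRiemannDeriv j f (c • z) := by
  rw [cauchyRiemannDeriv, cauchyRiemannDeriv, fderiv_comp_smul]
  simp only [smul_apply, Complex.real_smul]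
  ring

theorem continuous_cauchyRiemannDeriv (hf : ContDiff ℝ ∞ f) :
    Continuous (cauchyRiemannDeriv j f) := by
  have := hf.continuous_fderiv (by simp)
  unfold cauchyRiemannDeriv
  fun_prop

theorem hasCompactSupport_cauchyRiemannDeriv (hf : HasCompactSupport f) :
    HasCompactSupport (cauchyRiemannDeriv j f) :=
  (hf.fderiv (𝕜 := ℝ)).mono fun z hz h => hz (by simp [cauchyRiemannDeriv, h])

theorem cauchyRiemannDeriv_prodGaussianExp (a : ℝ) (B A : Config N →L[ℝ] ℂ) (z : Phase N) :
    cauchyRiemannDeriv j (prodGaussianExp a (holomorphicForm B + antiholomorphicForm A)) z =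
      (2 * B (EuclideanSpace.single j 1) - 2 * a * conjCoord j z) *
        prodGaussianExp a (holomorphicForm B + antiholomorphicForm A) z := by
  simp only [cauchyRiemannDeriv, fderiv_prodGaussianExp_apply, add_apply, holomorphicForm_apply,
    antiholomorphicForm_apply, conjCoord_apply, map_zero, inner_zero_right,
    EuclideanSpace.inner_single_right, RCLike.conj_to_real]
  simp only [mul_zero, add_zero, sub_zero, one_mul, zero_add, zero_sub]
  linear_combination (A (EuclideanSpace.single j 1) - B (EuclideanSpace.single j 1)) *
    prodGaussianExp a (holomorphicForm B + antiholomorphicForm A) z * Complex.I_sq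

theorem integral_cauchyRiemannDeriv_eq_zero (hf : ContDiff ℝ ∞ f) (hc : HasCompactSupport f) :
    ∫ z, cauchyRiemannDeriv j f z = 0 := by
  have : (volume : Measure (Phase N)).IsAddHaarMeasure := Measure.prod.instIsAddHaarMeasure _ _
  have integrable_fderiv (v : Phase N) : Integrable fun z => fderiv ℝ f z v := by
    have := hf.continuous_fderiv (by simp)
    exact Continuous.integrable_of_hasCompactSupport (by fun_prop)
      ((hc.fderiv (𝕜 := ℝ)).mono fun z hz h => hz (by simp [h]))
  have integral_fderiv (v : Phase N) : ∫ z, fderiv ℝ f z v = 0 := by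
    simpa using integral_mul_fderiv_eq_neg_fderiv_mul_of_integrable (𝕜 := ℂ) (μ := volume)
      (f := fun _ : Phase N => (1 : ℂ)) (g := f) (v := v) (by simp)
      (by simpa using integrable_fderiv v)
      (by simpa using hf.continuous.integrable_of_hasCompactSupport hc) (by fun_prop)
      (fun z _ => hf.differentiable (by simp) z)
  simp only [cauchyRiemannDeriv]
  rw [integral_sub (integrable_fderiv _) ((integrable_fderiv _).const_mul _), integral_const_mul,
    integral_fderiv, integral_fderiv, mul_zero, sub_zero]

theorem satisfiesCauchyRiemann_of_cauchyRiemannDeriv_eq_zero (hf : ContDiff ℝ ∞ f)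
    (h : cauchyRiemannDeriv j f = 0) : SatisfiesCauchyRiemann j f := by
  refine ⟨hf.continuous.locallyIntegrable, fun χ hχ hc => neg_eq_zero.2 ?_⟩
  rw [← integral_cauchyRiemannDeriv_eq_zero (j := j) (hf.mul hχ) hc.mul_left]
  congr 1 with z
  rw [cauchyRiemannDeriv_mul (hf.differentiable (by simp) z) (hχ.differentiable (by simp) z), h,
    Pi.zero_apply, zero_mul, add_zero]
  rfl

theorem exists_contDiff_hasCompactSupport_norm_le_one_eq_one_zero (N : ℕ) :
    ∃ χ : Phase N → ℂ, ContDiff ℝ ∞ χ ∧ HasCompactSupport χ ∧ (∀ z, ‖χ z‖ ≤ 1) ∧ χ 0 = 1 := by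
  let bump : ContDiffBump (0 : Phase N) := ⟨1, 2, one_pos, one_lt_two⟩
  refine ⟨fun z => (bump z : ℂ), Complex.ofRealCLM.contDiff.comp bump.contDiff,
    bump.hasCompactSupport.comp_left (g := Complex.ofReal) Complex.ofReal_zero, fun z => ?_, ?_⟩
  · rw [Complex.norm_real, Real.norm_of_nonneg bump.nonneg]
    exact bump.le_one
  · change ((bump 0 : ℝ) : ℂ) = 1
    rw [bump.one_of_mem_closedBall (Metric.mem_closedBall_self bump.rIn_pos.le),
      Complex.ofReal_one]

theorem cauchyRiemannDeriv_comp_smul_mul {χ : Phase N → ℂ} (hχ : ContDiff ℝ ∞ χ)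
    (hu : ContDiff ℝ ∞ u) (ε : ℝ) (z : Phase N) :
    cauchyRiemannDeriv j (fun z => χ (ε • z) * u z) z =
      χ (ε • z) * cauchyRiemannDeriv j u z + ε * cauchyRiemannDeriv j χ (ε • z) * u z := by
  have hχε : ContDiff ℝ ∞ fun z => χ (ε • z) := hχ.comp (contDiff_const_smul ε)
  rw [cauchyRiemannDeriv_mul (hχε.differentiable (by simp) z) (hu.differentiable (by simp) z),
    cauchyRiemannDeriv_comp_smul]

theorem tendsto_integral_mul_cauchyRiemannDeriv_cutoff (hF : AEStronglyMeasurable F)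
    (hu : ContDiff ℝ ∞ u) (hFu : Integrable fun z => F z * u z)
    (hFu' : Integrable fun z => F z * cauchyRiemannDeriv j u z) {χ : Phase N → ℂ}
    (hχ : ContDiff ℝ ∞ χ) (hc : HasCompactSupport χ) (hχ1 : ∀ z, ‖χ z‖ ≤ 1) (hχ0 : χ 0 = 1) :
    Filter.Tendsto (fun ε : ℝ => ∫ z, F z * cauchyRiemannDeriv j (fun z => χ (ε • z) * u z) z)
      (nhdsWithin 0 (Set.Ioi 0)) (nhds (∫ z, F z * cauchyRiemannDeriv j u z)) := by
  obtain ⟨C, hC⟩ := (hasCompactSupport_cauchyRiemannDeriv (j := j) hc).exists_bound_of_continuous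
    (continuous_cauchyRiemannDeriv hχ)
  refine tendsto_integral_filter_of_dominated_convergence
    (fun z => ‖F z * cauchyRiemannDeriv j u z‖ + C * ‖F z * u z‖) (.of_forall fun ε => ?_) ?_
    (hFu'.norm.add (hFu.norm.const_mul C)) (ae_of_all _ fun z => ?_)
  · exact hF.mul (continuous_cauchyRiemannDeriv
      ((hχ.comp (contDiff_const_smul ε)).mul hu)).aestronglyMeasurable
  · filter_upwards [Ioo_mem_nhdsGT one_pos] with ε hε
    refine ae_of_all _ fun z => ?_
    rw [cauchyRiemannDeriv_comp_smul_mul hχ hu, mul_add]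
    refine (norm_add_le _ _).trans (add_le_add ?_ ?_)
    · rw [mul_left_comm, norm_mul]
      exact mul_le_of_le_one_left (norm_nonneg _) (hχ1 _)
    · rw [mul_left_comm, norm_mul, norm_mul, Complex.norm_real, Real.norm_of_nonneg hε.1.le]
      gcongr
      exact (mul_le_of_le_one_left (norm_nonneg _) hε.2.le).trans (hC _)
  · have scaled : Filter.Tendsto (fun ε : ℝ => ε • z) (nhdsWithin 0 (Set.Ioi 0)) (nhds 0) := by
      have : Continuous fun ε : ℝ => ε • z := by fun_prop
      simpa using (this.tendsto 0).mono_left nhdsWithin_le_nhds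
    have cutoff := (hχ.continuous.tendsto 0).comp scaled
    have deriv := ((continuous_cauchyRiemannDeriv (j := j) hχ).tendsto 0).comp scaled
    have small : Filter.Tendsto (fun ε : ℝ => (ε : ℂ)) (nhdsWithin 0 (Set.Ioi 0)) (nhds 0) :=
      (Complex.continuous_ofReal.tendsto' 0 0 Complex.ofReal_zero).mono_left nhdsWithin_le_nhds
    simp_rw [cauchyRiemannDeriv_comp_smul_mul hχ hu]
    refine Filter.Tendsto.const_mul _ ?_
    simpa [hχ0] using (cutoff.mul_const (cauchyRiemannDeriv j u z)).add
      ((small.mul deriv).mul_const (u z))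

theorem SatisfiesCauchyRiemann.integral_mul_cauchyRiemannDeriv_eq_zero_of_hasCompactSupport
    (hF : SatisfiesCauchyRiemann j F) (hu : ContDiff ℝ ∞ u) (hc : HasCompactSupport u) :
    ∫ z, F z * cauchyRiemannDeriv j u z = 0 :=
  neg_eq_zero.1 (hF.2 u hu hc)

theorem SatisfiesCauchyRiemann.integral_mul_cauchyRiemannDeriv_eq_zero
    (hF : SatisfiesCauchyRiemann j F) (hu : ContDiff ℝ ∞ u) (hFu : Integrable fun z => F z * u z)
    (hFu' : Integrable fun z => F z * cauchyRiemannDeriv j u z) :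
    ∫ z, F z * cauchyRiemannDeriv j u z = 0 := by
  obtain ⟨χ, hχ, hc, hχ1, hχ0⟩ := exists_contDiff_hasCompactSupport_norm_le_one_eq_one_zero N
  refine tendsto_nhds_unique (tendsto_integral_mul_cauchyRiemannDeriv_cutoff
    hF.1.aestronglyMeasurable hu hFu hFu' hχ hc hχ1 hχ0) (tendsto_const_nhds.congr' ?_)
  filter_upwards [self_mem_nhdsWithin] with ε hε
  exact (hF.integral_mul_cauchyRiemannDeriv_eq_zero_of_hasCompactSupport
    ((hχ.comp (contDiff_const_smul ε)).mul hu)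
    (hc.comp_homeomorph (Homeomorph.smulOfNeZero ε (ne_of_gt hε))).mul_right).symm

end CauchyRiemann

section Isometry

theorem enorm_toLp_two_sq {α E : Type*} [MeasurableSpace α] {μ : Measure α}
    [NormedAddCommGroup E] {f : α → E} (hf : MemLp f 2 μ) :
    ‖hf.toLp f‖ₑ ^ 2 = ∫⁻ a, ‖f a‖ₑ ^ 2 ∂μ := by
  rw [Lp.enorm_toLp, eLpNorm_eq_lintegral_rpow_enorm_toReal (by norm_num) (by norm_num),
    ← ENNReal.rpow_natCast, ← ENNReal.rpow_mul]
  simp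

variable {N : ℕ} {ħ : ℝ}

theorem enorm_schwartzMap_toLp_two_sq (φ : 𝓢(Config N, ℂ)) :
    ‖φ.toLp 2‖ₑ ^ 2 = ∫⁻ y, ‖φ y‖ₑ ^ 2 := by
  rw [← enorm_toLp_two_sq (φ.memLp 2 volume)]
  rfl

theorem enorm_wavePacketConst_sq_mul (N : ℕ) (hħ : 0 < ħ) :
    ‖(((1 / (2 * Real.pi * ħ)) ^ ((N : ℝ) / 2) : ℝ) : ℂ)‖ₑ ^ 2 *
      ENNReal.ofReal |((2 * Real.pi * ħ)⁻¹ ^ N)⁻¹| = 1 := by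
  have sq_eq : ((1 / (2 * Real.pi * ħ)) ^ ((N : ℝ) / 2)) ^ 2 = (2 * Real.pi * ħ)⁻¹ ^ N := by
    rw [← Real.rpow_mul_natCast (by positivity), one_div, Nat.cast_ofNat,
      div_mul_cancel₀ _ two_ne_zero, Real.rpow_natCast]
  rw [← ofReal_norm, Complex.norm_real, Real.norm_eq_abs, ← ENNReal.ofReal_pow (abs_nonneg _),
    ← ENNReal.ofReal_mul (sq_nonneg _), sq_abs, sq_eq, abs_of_pos (by positivity),
    mul_inv_cancel₀ (by positivity), ENNReal.ofReal_one]

theorem enorm_wavePacketIntegral (ħ : ℝ) (φ ψ : Config N → ℂ) (z : Phase N) :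
    ‖wavePacketIntegral ħ φ ψ z‖ₑ = ‖(((1 / (2 * Real.pi * ħ)) ^ ((N : ℝ) / 2) : ℝ) : ℂ)‖ₑ *
      ‖∫ y : Config N, Complex.exp (-(Complex.I / ħ) * (inner ℝ z.2 y : ℝ)) *
        (ψ y * φ (z.1 - y))‖ₑ := by
  have enorm_phase : ‖Complex.exp (Complex.I / (2 * ħ) * (inner ℝ z.2 z.1 : ℝ))‖ₑ = 1 := by
    rw [← ofReal_norm, Complex.norm_exp]
    simp [Complex.div_re]
  rw [wavePacketIntegral, enorm_mul, enorm_mul, enorm_phase, mul_one]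

theorem lintegral_enorm_wavePacketIntegral_sq_fiber (hħ : 0 < ħ) (φ : 𝓢(Config N, ℂ))
    {ψ : Config N → ℂ} (hψ : MemLp ψ 2) (x : Config N) :
    ∫⁻ p, ‖wavePacketIntegral ħ φ ψ (x, p)‖ₑ ^ 2 = ∫⁻ y, ‖ψ y‖ₑ ^ 2 * ‖φ (x - y)‖ₑ ^ 2 := by
  simp_rw [enorm_wavePacketIntegral, mul_pow]
  rw [lintegral_const_mul' _ _ (by simp), lintegral_fourier_scaled hħ
    (integrable_mul_translate φ hψ x) (memLp_mul_translate φ hψ x), ← mul_assoc,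
    enorm_wavePacketConst_sq_mul N hħ, one_mul]
  simp_rw [enorm_mul, mul_pow]

theorem lintegral_lintegral_mul_sub {G : Type*} [AddCommGroup G] [MeasurableSpace G]
    [MeasurableAdd₂ G] [MeasurableNeg G] {μ : Measure G} [SFinite μ] [μ.IsAddRightInvariant]
    {f g : G → ℝ≥0∞} (hf : Measurable f) (hg : Measurable g) :
    ∫⁻ x, ∫⁻ y, f y * g (x - y) ∂μ ∂μ = (∫⁻ y, f y ∂μ) * ∫⁻ x, g x ∂μ := by
  have hfg : Measurable fun q : G × G => f q.2 * g (q.1 - q.2) := by fun_prop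
  rw [lintegral_lintegral_swap hfg.aemeasurable, ← lintegral_mul_const _ hf]
  congr 1 with y
  rw [lintegral_const_mul _ (by fun_prop), lintegral_sub_right_eq_self g y]

theorem lintegral_enorm_wavePacketIntegral_sq (hħ : 0 < ħ) (φ : 𝓢(Config N, ℂ))
    {ψ : Config N → ℂ} (hψ : StronglyMeasurable ψ) (hψ2 : MemLp ψ 2) :
    ∫⁻ z, ‖wavePacketIntegral ħ φ ψ z‖ₑ ^ 2 = (∫⁻ y, ‖ψ y‖ₑ ^ 2) * ∫⁻ y, ‖φ y‖ₑ ^ 2 := by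
  have hU := (stronglyMeasurable_wavePacketIntegral ħ φ hψ).measurable.enorm.pow_const 2
  rw [Measure.volume_eq_prod, lintegral_prod _ hU.aemeasurable]
  simp_rw [lintegral_enorm_wavePacketIntegral_sq_fiber hħ φ hψ2]
  exact lintegral_lintegral_mul_sub (hψ.measurable.enorm.pow_const 2)
    (φ.continuous.measurable.enorm.pow_const 2)

theorem norm_wavePacketTransform (hħ : 0 < ħ) (φ : 𝓢(Config N, ℂ))
    (ψ : Lp ℂ 2 (volume : Measure (Config N))) :
    ‖wavePacketTransform ħ hħ φ ψ‖ = ‖ψ‖ * ‖φ.toLp 2‖ := by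
  have enorm_sq : ‖wavePacketTransform ħ hħ φ ψ‖ₑ ^ 2 = (‖ψ‖ₑ * ‖φ.toLp 2‖ₑ) ^ 2 := by
    have enorm_ψ := enorm_toLp_two_sq (Lp.memLp ψ)
    rw [Lp.toLp_coeFn] at enorm_ψ
    rw [mul_pow, enorm_ψ, enorm_schwartzMap_toLp_two_sq,
      ← lintegral_enorm_wavePacketIntegral_sq hħ φ (Lp.stronglyMeasurable ψ) (Lp.memLp ψ)]
    exact enorm_toLp_two_sq (memLp_wavePacketIntegral hħ φ ψ)
  have enorm_eq := (ENNReal.pow_right_strictMono two_ne_zero).injective enorm_sq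
  simpa using congrArg ENNReal.toReal enorm_eq

/-- The wave-packet transform with a normalized window, as a linear isometry. -/
def wavePacketIsometry (hħ : 0 < ħ) {φ : 𝓢(Config N, ℂ)} (hφ : ‖φ.toLp 2‖ = 1) :
    Lp ℂ 2 (volume : Measure (Config N)) →ₗᵢ[ℂ] Lp ℂ 2 (volume : Measure (Phase N)) where
  toLinearMap := wavePacketTransform ħ hħ φ
  norm_map' ψ := by rw [norm_wavePacketTransform, hφ, mul_one]

theorem isClosed_wavePacketRange (hħ : 0 < ħ) {φ : 𝓢(Config N, ℂ)} (hφ : ‖φ.toLp 2‖ = 1) :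
    IsClosed (wavePacketRange ħ hħ φ : Set (Lp ℂ 2 (volume : Measure (Phase N)))) :=
  (wavePacketIsometry hħ hφ).isometry.isClosedEmbedding.isClosed_range

theorem nonempty_wavePacketRange_linearIsometryEquiv (hħ : 0 < ħ) {φ φ' : 𝓢(Config N, ℂ)}
    (hφ : ‖φ.toLp 2‖ = 1) (hφ' : ‖φ'.toLp 2‖ = 1) :
    Nonempty (wavePacketRange ħ hħ φ ≃ₗᵢ[ℂ] wavePacketRange ħ hħ φ') :=
  ⟨(wavePacketIsometry hħ hφ).equivRange.symm.trans (wavePacketIsometry hħ hφ').equivRange⟩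

theorem norm_standardGaussian_apply_sq (hħ : 0 < ħ) (v : Config N) :
    ‖standardGaussian N ħ hħ v‖ ^ 2 =
      (1 / (Real.pi * ħ)) ^ ((N : ℝ) / 2) * Real.exp (-(1 / ħ) * ‖v‖ ^ 2) := by
  change ‖((((1 / (Real.pi * ħ)) ^ ((N : ℝ) / 4) *
    Real.exp (-(1 / (2 * ħ)) * ‖v‖ ^ 2) : ℝ)) : ℂ)‖ ^ 2 = _
  rw [Complex.norm_real, Real.norm_eq_abs, sq_abs, mul_pow, ← Real.exp_nat_mul,
    ← Real.rpow_mul_natCast (by positivity)]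
  congr 2
  · push_cast
    ring
  · push_cast
    field_simp

theorem norm_standardGaussian (N : ℕ) (hħ : 0 < ħ) : ‖(standardGaussian N ħ hħ).toLp 2‖ = 1 := by
  have memLp : MemLp (standardGaussian N ħ hħ) 2 := (standardGaussian N ħ hħ).memLp 2
  have integral_eq_one : ∫ v, ‖standardGaussian N ħ hħ v‖ ^ 2 = 1 := by
    simp_rw [norm_standardGaussian_apply_sq]
    rw [integral_const_mul, GaussianFourier.integral_rexp_neg_mul_sq_norm (by positivity),
      finrank_euclideanSpace, Fintype.card_fin, ← Real.mul_rpow (by positivity) (by positivity),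
      show 1 / (Real.pi * ħ) * (Real.pi / (1 / ħ)) = 1 by field_simp, Real.one_rpow]
  have enorm_sq : ‖(standardGaussian N ħ hħ).toLp 2‖ₑ ^ 2 = 1 := by
    simp_rw [enorm_schwartzMap_toLp_two_sq, ← ofReal_norm, ← ENNReal.ofReal_pow (norm_nonneg _)]
    rw [← ofReal_integral_eq_lintegral_ofReal
      (memLp.integrable_norm_pow two_ne_zero) (ae_of_all _ fun v => by positivity),
      integral_eq_one, ENNReal.ofReal_one]
  rw [← ofReal_norm, ← ENNReal.ofReal_pow (norm_nonneg _), ENNReal.ofReal_eq_one] at enorm_sq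
  exact (pow_eq_one_iff_of_nonneg (norm_nonneg _) two_ne_zero).1 enorm_sq

end Isometry

section CoherentStates

variable {N : ℕ} {a ħ : ℝ}

/-- The complex bilinear extension of the Euclidean inner product to complex valued forms. -/
def formDot (A B : Config N →L[ℝ] ℂ) : ℂ :=
  ∑ j, A (EuclideanSpace.single j 1) * B (EuclideanSpace.single j 1)

theorem formDot_add_smul_self (A B : Config N →L[ℝ] ℂ) (c : ℂ) :
    formDot (A + c • B) (A + c • B) =
      formDot A A + 2 * c * formDot A B + c ^ 2 * formDot B B := by
  simp only [formDot, add_apply, smul_apply, smul_eq_mul, Finset.mul_sum,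
    ← Finset.sum_add_distrib]
  exact Finset.sum_congr rfl fun j _ => by ring

/-- The form `y ↦ (x - ip) · y` attached to the phase space point `z = (x, p)`. -/
def conjPointForm (z : Phase N) : Config N →L[ℝ] ℂ :=
  Complex.ofRealCLM ∘L innerSL ℝ z.1 - Complex.I • (Complex.ofRealCLM ∘L innerSL ℝ z.2)

theorem conjPointForm_apply (z : Phase N) (y : Config N) :
    conjPointForm z y = (inner ℝ z.1 y : ℂ) - Complex.I * (inner ℝ z.2 y : ℂ) := rfl

theorem conjPointForm_single (z : Phase N) (j : Fin N) :
    conjPointForm z (EuclideanSpace.single j 1) = conjCoord j z := by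
  simp only [conjPointForm_apply, conjCoord_apply, EuclideanSpace.inner_single_right, one_mul,
    RCLike.conj_to_real]

theorem formDot_conjPointForm (A : Config N →L[ℝ] ℂ) (z : Phase N) :
    formDot A (conjPointForm z) = antiholomorphicForm A z := by
  rw [antiholomorphicForm_eq_sum_conjCoord, formDot]
  simp_rw [conjPointForm_single]

theorem formDot_conjPointForm_self (z : Phase N) :
    formDot (conjPointForm z) (conjPointForm z) =
      (‖z.1‖ ^ 2 : ℝ) - (‖z.2‖ ^ 2 : ℝ) - 2 * Complex.I * (inner ℝ z.2 z.1 : ℝ) := by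
  rw [formDot_conjPointForm, antiholomorphicForm_apply, conjPointForm_apply, conjPointForm_apply,
    real_inner_self_eq_norm_sq, real_inner_self_eq_norm_sq, real_inner_comm]
  linear_combination ((‖z.2‖ ^ 2 : ℝ) : ℂ) * Complex.I_sq

theorem integral_gaussianExp (ha : 0 < a) (L : Config N →L[ℝ] ℂ) :
    ∫ y, gaussianExp a L y =
      (Real.pi / a) ^ ((N : ℂ) / 2) * Complex.exp (formDot L L / (4 * a)) := by
  have h := GaussianFourier.integral_cexp_neg_mul_sum_add (b := a) (by simpa using ha)
    fun j : Fin N => L (EuclideanSpace.single j 1)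
  rw [Fintype.card_fin] at h
  simp_rw [formDot, ← pow_two]
  rw [← h, ← (PiLp.volume_preserving_toLp (Fin N)).integral_comp
    (MeasurableEquiv.toLp 2 _).measurableEmbedding]
  congr 1 with y
  rw [gaussianExp, apply_eq_sum_mul_single L, EuclideanSpace.real_norm_sq_eq]
  push_cast
  rfl

theorem standardGaussian_eq_mul_gaussianExp (hħ : 0 < ħ) (x : Config N) :
    standardGaussian N ħ hħ x =
      (((1 / (Real.pi * ħ)) ^ ((N : ℝ) / 4) : ℝ) : ℂ) * gaussianExp (1 / (2 * ħ)) 0 x := by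
  rw [gaussianExp, zero_apply, add_zero, ← Complex.ofReal_neg, ← Complex.ofReal_mul,
    ← Complex.ofReal_exp, ← Complex.ofReal_mul]
  rfl

theorem cexp_mul_gaussianExp_mul_gaussianExp (hħ : 0 < ħ) (L : Config N →L[ℝ] ℂ)
    (z : Phase N) (y : Config N) :
    Complex.exp (-(Complex.I / ħ) * (inner ℝ z.2 y : ℝ)) *
        (gaussianExp (1 / (2 * ħ)) L y * gaussianExp (1 / (2 * ħ)) 0 (z.1 - y)) =
      gaussianExp (1 / (2 * ħ)) 0 z.1 *
        gaussianExp (1 / ħ) (L + (1 / ħ : ℂ) • conjPointForm z) y := by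
  have hħ' : (ħ : ℂ) ≠ 0 := Complex.ofReal_ne_zero.2 hħ.ne'
  simp only [gaussianExp, ← Complex.exp_add]
  congr 1
  rw [norm_sub_sq_real, add_apply, smul_apply, conjPointForm_apply, smul_eq_mul, zero_apply,
    zero_apply]
  push_cast
  field_simp
  ring

theorem cexp_mul_gaussianExp_mul_cexp_formDot (hħ : 0 < ħ) (L : Config N →L[ℝ] ℂ)
    (z : Phase N) :
    Complex.exp (Complex.I / (2 * ħ) * (inner ℝ z.2 z.1 : ℝ)) * gaussianExp (1 / (2 * ħ)) 0 z.1 *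
        Complex.exp (formDot (L + (1 / ħ : ℂ) • conjPointForm z)
          (L + (1 / ħ : ℂ) • conjPointForm z) / (4 * (1 / ħ : ℝ))) =
      Complex.exp (ħ / 4 * formDot L L) *
        prodGaussianExp (1 / (4 * ħ)) (antiholomorphicForm ((1 / 2 : ℂ) • L)) z := by
  have hħ' : (ħ : ℂ) ≠ 0 := Complex.ofReal_ne_zero.2 hħ.ne'
  simp only [gaussianExp, prodGaussianExp, ← Complex.exp_add]
  congr 1
  rw [formDot_add_smul_self, formDot_conjPointForm, formDot_conjPointForm_self, zero_apply]
  simp only [antiholomorphicForm_apply, smul_apply, smul_eq_mul]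
  push_cast
  field_simp
  ring

theorem wavePacketIntegral_gaussianExp (hħ : 0 < ħ) (L : Config N →L[ℝ] ℂ) :
    ∃ C : ℂ, C ≠ 0 ∧ ∀ z,
      wavePacketIntegral ħ (standardGaussian N ħ hħ) (gaussianExp (1 / (2 * ħ)) L) z =
        C * prodGaussianExp (1 / (4 * ħ)) (antiholomorphicForm ((1 / 2 : ℂ) • L)) z := by
  let c₀ : ℂ := (((1 / (2 * Real.pi * ħ)) ^ ((N : ℝ) / 2) : ℝ) : ℂ)
  let c₁ : ℂ := (((1 / (Real.pi * ħ)) ^ ((N : ℝ) / 4) : ℝ) : ℂ)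
  let c₂ : ℂ := (Real.pi / ((1 / ħ : ℝ) : ℂ)) ^ ((N : ℂ) / 2)
  have hc₀ : c₀ ≠ 0 := Complex.ofReal_ne_zero.2 (by positivity)
  have hc₁ : c₁ ≠ 0 := Complex.ofReal_ne_zero.2 (by positivity)
  have hc₂ : c₂ ≠ 0 := Complex.cpow_ne_zero_iff.2 (.inl (div_ne_zero
    (Complex.ofReal_ne_zero.2 Real.pi_ne_zero) (Complex.ofReal_ne_zero.2 (by positivity))))
  refine ⟨c₀ * c₁ * c₂ * Complex.exp (ħ / 4 * formDot L L),
    mul_ne_zero (mul_ne_zero (mul_ne_zero hc₀ hc₁) hc₂) (Complex.exp_ne_zero _), fun z => ?_⟩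
  have integrand (y : Config N) : Complex.exp (-(Complex.I / ħ) * (inner ℝ z.2 y : ℝ)) *
      (gaussianExp (1 / (2 * ħ)) L y * standardGaussian N ħ hħ (z.1 - y)) =
      c₁ * gaussianExp (1 / (2 * ħ)) 0 z.1 *
        gaussianExp (1 / ħ) (L + (1 / ħ : ℂ) • conjPointForm z) y := by
    rw [standardGaussian_eq_mul_gaussianExp, mul_left_comm _ c₁, mul_left_comm _ c₁,
      cexp_mul_gaussianExp_mul_gaussianExp hħ, mul_assoc]
  simp_rw [wavePacketIntegral, integrand]
  rw [integral_const_mul, integral_gaussianExp (by positivity)]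
  linear_combination c₀ * c₁ * c₂ * cexp_mul_gaussianExp_mul_cexp_formDot hħ L z

/-- The coherent state `exp (-a(|x|² + |p|²) + A(x - ip))`, an element of `L²` of phase space. -/
def coherentState (ha : 0 < a) (A : Config N →L[ℝ] ℂ) : Lp ℂ 2 (volume : Measure (Phase N)) :=
  (memLp_prodGaussianExp ha (antiholomorphicForm A)).toLp _

theorem wavePacketIntegral_congr (ħ : ℝ) (φ : Config N → ℂ) {ψ ψ' : Config N → ℂ}
    (h : ψ =ᵐ[volume] ψ') : wavePacketIntegral ħ φ ψ = wavePacketIntegral ħ φ ψ' := by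
  ext z
  rw [wavePacketIntegral, wavePacketIntegral]
  congr 1
  refine integral_congr_ae ?_
  filter_upwards [h] with y hy
  rw [hy]

theorem wavePacketTransform_toLp_gaussianExp (hħ : 0 < ħ) (L : Config N →L[ℝ] ℂ) :
    ∃ C : ℂ, C ≠ 0 ∧ wavePacketTransform ħ hħ (standardGaussian N ħ hħ)
      ((memLp_gaussianExp (a := 1 / (2 * ħ)) (by positivity) L).toLp _) =
        C • coherentState (a := 1 / (4 * ħ)) (by positivity) ((1 / 2 : ℂ) • L) := by
  obtain ⟨C, hC, h⟩ := wavePacketIntegral_gaussianExp hħ L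
  refine ⟨C, hC, ?_⟩
  rw [coherentState, ← MemLp.toLp_const_smul]
  refine MemLp.toLp_congr (memLp_wavePacketIntegral hħ _ _) _ (ae_of_all _ fun z => ?_)
  rw [wavePacketIntegral_congr ħ _ (MemLp.coeFn_toLp _), h, Pi.smul_apply, smul_eq_mul]

theorem coherentState_mem_wavePacketRange (hħ : 0 < ħ) (A : Config N →L[ℝ] ℂ) :
    coherentState (a := 1 / (4 * ħ)) (by positivity) A ∈
      wavePacketRange ħ hħ (standardGaussian N ħ hħ) := by
  obtain ⟨C, hC, h⟩ := wavePacketTransform_toLp_gaussianExp hħ ((2 : ℂ) • A)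
  have half_two_smul : (1 / 2 : ℂ) • (2 : ℂ) • A = A := by
    rw [one_div, inv_smul_smul₀ two_ne_zero]
  rw [half_two_smul] at h
  exact (Submodule.smul_mem_iff _ hC).1 (h ▸ LinearMap.mem_range_self _ _)

theorem inner_toLp_left {α : Type*} [MeasurableSpace α] {μ : Measure α} {f : α → ℂ}
    (hf : MemLp f 2 μ) (g : Lp ℂ 2 μ) :
    inner ℂ (hf.toLp f) g = ∫ x, g x * starRingEnd ℂ (f x) ∂μ := by
  rw [L2.inner_def]
  refine integral_congr_ae ?_
  filter_upwards [hf.coeFn_toLp] with x hx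
  rw [hx, RCLike.inner_apply]

theorem conj_gaussianExp {E : Type*} [NormedAddCommGroup E] [NormedSpace ℝ E] (a : ℝ)
    (L : E →L[ℝ] ℂ) (v : E) : starRingEnd ℂ (gaussianExp a L v) =
      gaussianExp a ((Complex.conjCLE : ℂ →L[ℝ] ℂ) ∘L L) v := by
  rw [gaussianExp, gaussianExp, ← Complex.exp_conj, map_add, map_mul, map_neg, Complex.conj_ofReal,
    Complex.conj_ofReal]
  rfl

theorem conjCLE_comp_conjCLE_comp {E : Type*} [NormedAddCommGroup E] [NormedSpace ℝ E]
    (L : E →L[ℝ] ℂ) :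
    (Complex.conjCLE : ℂ →L[ℝ] ℂ) ∘L ((Complex.conjCLE : ℂ →L[ℝ] ℂ) ∘L L) = L :=
  ContinuousLinearMap.ext fun v => Complex.conj_conj (L v)

theorem eq_zero_of_inner_toLp_gaussianExp_eq_zero {V : Type*} [NormedAddCommGroup V]
    [InnerProductSpace ℝ V] [FiniteDimensional ℝ V] [MeasurableSpace V] [BorelSpace V]
    (ha : 0 < a) {f : Lp ℂ 2 (volume : Measure V)}
    (h : ∀ L, inner ℂ ((memLp_gaussianExp ha L).toLp _) f = 0) : f = 0 := by
  rw [Lp.eq_zero_iff_ae_eq_zero]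
  refine ae_eq_zero_of_integral_mul_gaussianExp_eq_zero ha (Lp.memLp f) fun L => ?_
  have hL := h ((Complex.conjCLE : ℂ →L[ℝ] ℂ) ∘L L)
  simp_rw [inner_toLp_left, conj_gaussianExp, conjCLE_comp_conjCLE_comp] at hL
  exact hL

theorem eq_zero_of_mem_wavePacketRange_of_inner_coherentState_eq_zero (hħ : 0 < ħ)
    {Ψ : Lp ℂ 2 (volume : Measure (Phase N))}
    (hΨ : Ψ ∈ wavePacketRange ħ hħ (standardGaussian N ħ hħ))
    (h : ∀ A, inner ℂ (coherentState (a := 1 / (4 * ħ)) (by positivity) A) Ψ = 0) : Ψ = 0 := by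
  obtain ⟨ψ, rfl⟩ := hΨ
  suffices ψ = 0 by rw [this, map_zero]
  refine eq_zero_of_inner_toLp_gaussianExp_eq_zero (a := 1 / (2 * ħ)) (by positivity) fun L => ?_
  obtain ⟨C, -, hC⟩ := wavePacketTransform_toLp_gaussianExp hħ L
  rw [← (wavePacketIsometry hħ (norm_standardGaussian N hħ)).inner_map_map]
  change inner ℂ (wavePacketTransform ħ hħ _ _) (wavePacketTransform ħ hħ _ ψ) = 0
  rw [hC, inner_smul_left, h, mul_zero]

end CoherentStates

section CauchyRiemannSpace

variable {N : ℕ} {a : ℝ}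

theorem SatisfiesCauchyRiemann.congr_ae {j : Fin N} {F G : Phase N → ℂ}
    (hF : SatisfiesCauchyRiemann j F) (h : F =ᵐ[volume] G) : SatisfiesCauchyRiemann j G := by
  refine ⟨hF.1.congr h, fun χ hχ hc => ?_⟩
  rw [← hF.2 χ hχ hc]
  congr 1
  refine integral_congr_ae ?_
  filter_upwards [h] with z hz
  rw [hz]

theorem satisfiesCauchyRiemann_prodGaussianExp_antiholomorphicForm (j : Fin N)
    (A : Config N →L[ℝ] ℂ) :
    SatisfiesCauchyRiemann j (prodGaussianExp 0 (antiholomorphicForm A)) := by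
  have holomorphicForm_zero : holomorphicForm (0 : Config N →L[ℝ] ℂ) = 0 :=
    ContinuousLinearMap.ext fun z => by simp [holomorphicForm_apply]
  refine satisfiesCauchyRiemann_of_cauchyRiemannDeriv_eq_zero (contDiff_prodGaussianExp 0 _)
    (funext fun z => ?_)
  have h := cauchyRiemannDeriv_prodGaussianExp (j := j) 0 0 A z
  rw [holomorphicForm_zero, zero_add] at h
  simp [h]

theorem memLp_conj_prodGaussianExp_mul_cauchyRiemannDeriv (a : ℝ) (j : Fin N) {χ : Phase N → ℂ}
    (hχ : ContDiff ℝ ∞ χ) (hc : HasCompactSupport χ) :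
    MemLp (fun z => starRingEnd ℂ (prodGaussianExp a 0 z * cauchyRiemannDeriv j χ z)) 2 := by
  have : Continuous (cauchyRiemannDeriv j χ) := continuous_cauchyRiemannDeriv hχ
  have : Continuous fun z => prodGaussianExp a 0 z * cauchyRiemannDeriv j χ z := by fun_prop
  exact (this.memLp_of_hasCompactSupport (hasCompactSupport_cauchyRiemannDeriv hc).mul_left).star

/-- The `Ψ` in `L²` of phase space for which `exp (a(|x|² + |p|²)) Ψ` satisfies the Cauchy-Riemann
equations in the sense of distributions. It is encoded as an orthogonal complement: each test
function `χ` turns the equation into orthogonality of `Ψ` to a function in `L²`, and this makes the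
space visibly a closed subspace. -/
def cauchyRiemannSpace (N : ℕ) (a : ℝ) : Submodule ℂ (Lp ℂ 2 (volume : Measure (Phase N))) :=
  (Submodule.span ℂ {Θ | ∃ (j : Fin N) (χ : Phase N → ℂ) (hχ : ContDiff ℝ ∞ χ)
    (hc : HasCompactSupport χ),
      (memLp_conj_prodGaussianExp_mul_cauchyRiemannDeriv (-a) j hχ hc).toLp _ = Θ})ᗮ

theorem isClosed_cauchyRiemannSpace (N : ℕ) (a : ℝ) :
    IsClosed (cauchyRiemannSpace N a : Set (Lp ℂ 2 (volume : Measure (Phase N)))) :=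
  Submodule.isClosed_orthogonal _

theorem mem_cauchyRiemannSpace_iff {Ψ : Lp ℂ 2 (volume : Measure (Phase N))} :
    Ψ ∈ cauchyRiemannSpace N a ↔
      ∀ j, SatisfiesCauchyRiemann j fun z => prodGaussianExp (-a) 0 z * Ψ z := by
  have inner_eq (j : Fin N) {χ : Phase N → ℂ} (hχ : ContDiff ℝ ∞ χ) (hc : HasCompactSupport χ) :
      inner ℂ ((memLp_conj_prodGaussianExp_mul_cauchyRiemannDeriv (-a) j hχ hc).toLp _) Ψ =
        ∫ z, prodGaussianExp (-a) 0 z * Ψ z * cauchyRiemannDeriv j χ z := by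
    simp_rw [inner_toLp_left, Complex.conj_conj, ← mul_assoc, mul_comm (Ψ _)]
  have locallyIntegrable : LocallyIntegrable fun z => prodGaussianExp (-a) 0 z * Ψ z :=
    ((Lp.memLp Ψ).locallyIntegrable one_le_two).continuous_mul (continuous_prodGaussianExp _ _)
  rw [cauchyRiemannSpace, ← Submodule.span_singleton_le_iff_mem, ← Submodule.isOrtho_iff_le,
    Submodule.isOrtho_comm, Submodule.isOrtho_span]
  constructor
  · exact fun h j => ⟨locallyIntegrable, fun χ hχ hc => neg_eq_zero.2
      ((inner_eq j hχ hc).symm.trans (h ⟨j, χ, hχ, hc, rfl⟩ rfl))⟩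
  · rintro h _ ⟨j, χ, hχ, hc, rfl⟩ _ rfl
    rw [inner_eq j hχ hc]
    exact (h j).integral_mul_cauchyRiemannDeriv_eq_zero_of_hasCompactSupport hχ hc

theorem coherentState_mem_cauchyRiemannSpace (ha : 0 < a) (A : Config N →L[ℝ] ℂ) :
    coherentState ha A ∈ cauchyRiemannSpace N a := by
  refine mem_cauchyRiemannSpace_iff.2 fun j =>
    (satisfiesCauchyRiemann_prodGaussianExp_antiholomorphicForm j A).congr_ae ?_
  filter_upwards [MemLp.coeFn_toLp (memLp_prodGaussianExp ha (antiholomorphicForm A))] with z hz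
  rw [coherentState, hz, prodGaussianExp_mul, neg_add_cancel, zero_add]

variable {Ψ : Lp ℂ 2 (volume : Measure (Phase N))}

theorem integrable_mul_clm_mul_prodGaussianExp (ha : 0 < a)
    (Ψ : Lp ℂ 2 (volume : Measure (Phase N))) (A M : Phase N →L[ℝ] ℂ) :
    Integrable fun z => Ψ z * (A z * prodGaussianExp a M z) :=
  (Lp.memLp Ψ).integrable_mul (memLp_clm_mul_prodGaussianExp ha A M)

/- The Cauchy-Riemann equations are tested against the Gaussian `exp (-2a|z|² + M z)`, one half of
which compensates the weight `exp (a|z|²)`. -/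
theorem integral_mul_conjCoord_mul_prodGaussianExp (ha : 0 < a) (hΨ : Ψ ∈ cauchyRiemannSpace N a)
    (B A : Config N →L[ℝ] ℂ) (j : Fin N) :
    ∫ z, Ψ z * (conjCoord j z * prodGaussianExp a (holomorphicForm B + antiholomorphicForm A) z) =
      B (EuclideanSpace.single j 1) / (2 * a) *
        ∫ z, Ψ z * prodGaussianExp a (holomorphicForm B + antiholomorphicForm A) z := by
  let M := holomorphicForm B + antiholomorphicForm A
  change ∫ z, Ψ z * (conjCoord j z * prodGaussianExp a M z) =
    B (EuclideanSpace.single j 1) / (2 * a) * ∫ z, Ψ z * prodGaussianExp a M z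
  have weight (z : Phase N) :
      prodGaussianExp (-a) 0 z * prodGaussianExp (2 * a) M z = prodGaussianExp a M z := by
    rw [prodGaussianExp_mul, zero_add]
    congr 1
    ring
  have tested (z : Phase N) :
      prodGaussianExp (-a) 0 z * Ψ z * cauchyRiemannDeriv j (prodGaussianExp (2 * a) M) z =
        2 * B (EuclideanSpace.single j 1) * (Ψ z * prodGaussianExp a M z) -
          4 * a * (Ψ z * (conjCoord j z * prodGaussianExp a M z)) := by
    rw [cauchyRiemannDeriv_prodGaussianExp, ← weight]
    push_cast
    ring
  have integrable : Integrable fun z => Ψ z * prodGaussianExp a M z :=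
    (Lp.memLp Ψ).integrable_mul (memLp_prodGaussianExp ha M)
  have integrable_conjCoord := integrable_mul_clm_mul_prodGaussianExp ha Ψ (conjCoord j) M
  have integrable_tested :=
    (integrable.const_mul (2 * B (EuclideanSpace.single j 1))).sub
      (integrable_conjCoord.const_mul (4 * a))
  have h := (mem_cauchyRiemannSpace_iff.1 hΨ j).integral_mul_cauchyRiemannDeriv_eq_zero
    (contDiff_prodGaussianExp (2 * a) M)
    (integrable.congr (.of_forall fun z => by simp only [← weight]; ring))
    (integrable_tested.congr (.of_forall fun z => (tested z).symm))
  simp_rw [tested] at h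
  rw [integral_sub (integrable.const_mul _) (integrable_conjCoord.const_mul _), integral_const_mul,
    integral_const_mul] at h
  have ha' : (a : ℂ) ≠ 0 := Complex.ofReal_ne_zero.2 ha.ne'
  rw [div_mul_eq_mul_div, eq_div_iff (mul_ne_zero two_ne_zero ha')]
  linear_combination -h / 2

theorem integral_mul_antiholomorphicForm_mul_prodGaussianExp (ha : 0 < a)
    (hΨ : Ψ ∈ cauchyRiemannSpace N a) (B A A' : Config N →L[ℝ] ℂ) :
    ∫ z, Ψ z * (antiholomorphicForm A' z *
        prodGaussianExp a (holomorphicForm B + antiholomorphicForm A) z) =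
      formDot A' B / (2 * a) *
        ∫ z, Ψ z * prodGaussianExp a (holomorphicForm B + antiholomorphicForm A) z := by
  simp_rw [antiholomorphicForm_eq_sum_conjCoord A', Finset.sum_mul, Finset.mul_sum, mul_assoc,
    mul_left_comm (Ψ _) (A' _)]
  rw [integral_finsetSum _ fun j _ =>
    (integrable_mul_clm_mul_prodGaussianExp ha Ψ (conjCoord j) _).const_mul _, formDot,
    Finset.sum_div, Finset.sum_mul]
  refine Finset.sum_congr rfl fun j _ => ?_
  rw [integral_const_mul, integral_mul_conjCoord_mul_prodGaussianExp ha hΨ]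
  ring

theorem eq_cexp_mul_of_hasDerivAt {y : ℝ → ℂ} {c : ℂ} (hy : ∀ t, HasDerivAt y (c * y t) t)
    (t : ℝ) : y t = Complex.exp (c * t) * y 0 := by
  have hasDerivAt_zero (s : ℝ) : HasDerivAt (fun s : ℝ => Complex.exp (-c * s) * y s) 0 s := by
    have hexp : HasDerivAt (fun s : ℝ => Complex.exp (-c * s)) _ s :=
      ((hasDerivAt_id (s : ℂ)).comp_ofReal.const_mul (-c)).cexp
    refine (hexp.mul (hy s)).congr_deriv ?_
    rw [id_eq]
    ring
  have const := is_const_of_deriv_eq_zero (fun s => (hasDerivAt_zero s).differentiableAt)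
    (fun s => (hasDerivAt_zero s).deriv) t 0
  simp only [Complex.ofReal_zero, mul_zero, Complex.exp_zero, one_mul] at const
  rw [← const, ← mul_assoc, ← Complex.exp_add, neg_mul, add_neg_cancel, Complex.exp_zero, one_mul]

theorem integral_mul_prodGaussianExp_holomorphicForm_add_antiholomorphicForm (ha : 0 < a)
    (hΨ : Ψ ∈ cauchyRiemannSpace N a) (B A : Config N →L[ℝ] ℂ) :
    ∫ z, Ψ z * prodGaussianExp a (holomorphicForm B + antiholomorphicForm A) z =
      Complex.exp (formDot A B / (2 * a)) * ∫ z, Ψ z * prodGaussianExp a (holomorphicForm B) z := by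
  have smul_antiholomorphicForm (t : ℝ) :
      t • antiholomorphicForm A = antiholomorphicForm (t • A) :=
    ContinuousLinearMap.ext fun z => by
      simp only [smul_apply, antiholomorphicForm_apply, Complex.real_smul]
      ring
  have hasDerivAt (t : ℝ) := hasDerivAt_integral_mul_prodGaussianExp ha (Lp.memLp Ψ)
    (holomorphicForm B) (antiholomorphicForm A) t
  simp_rw [smul_antiholomorphicForm,
    integral_mul_antiholomorphicForm_mul_prodGaussianExp ha hΨ] at hasDerivAt
  have h := eq_cexp_mul_of_hasDerivAt hasDerivAt 1
  rw [one_smul, ← smul_antiholomorphicForm, zero_smul ℝ (antiholomorphicForm A),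
    add_zero, Complex.ofReal_one, mul_one] at h
  exact h

theorem eq_zero_of_mem_cauchyRiemannSpace_of_inner_coherentState_eq_zero (ha : 0 < a)
    (hΨ : Ψ ∈ cauchyRiemannSpace N a) (h : ∀ A, inner ℂ (coherentState ha A) Ψ = 0) : Ψ = 0 := by
  have holomorphic_zero (B : Config N →L[ℝ] ℂ) :
      ∫ z, Ψ z * prodGaussianExp a (holomorphicForm B) z = 0 := by
    have hB := h ((Complex.conjCLE : ℂ →L[ℝ] ℂ) ∘L B)
    simp_rw [coherentState, inner_toLp_left, conj_prodGaussianExp_antiholomorphicForm,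
      conjCLE_comp_conjCLE_comp] at hB
    exact hB
  rw [Lp.eq_zero_iff_ae_eq_zero]
  refine ae_eq_zero_of_integral_mul_prodGaussianExp_eq_zero ha (Lp.memLp Ψ) fun M => ?_
  obtain ⟨B, A, rfl⟩ := exists_eq_holomorphicForm_add_antiholomorphicForm M
  rw [integral_mul_prodGaussianExp_holomorphicForm_add_antiholomorphicForm ha hΨ,
    holomorphic_zero, mul_zero]

end CauchyRiemannSpace

theorem topologicalClosure_span_eq_of_inner_eq_zero {𝕜 H : Type*} [RCLike 𝕜]
    [NormedAddCommGroup H] [InnerProductSpace 𝕜 H] [CompleteSpace H] {S : Set H}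
    {K : Submodule 𝕜 H} (hK : IsClosed (K : Set H)) (hS : S ⊆ K)
    (h : ∀ x ∈ K, (∀ s ∈ S, inner 𝕜 s x = 0) → x = 0) :
    (Submodule.span 𝕜 S).topologicalClosure = K := by
  have closure_le : (Submodule.span 𝕜 S).topologicalClosure ≤ K :=
    Submodule.topologicalClosure_minimal _ (Submodule.span_le.2 hS) hK
  have orthogonal_inf : (Submodule.span 𝕜 S).topologicalClosureᗮ ⊓ K = ⊥ := by
    refine (Submodule.eq_bot_iff _).2 fun x hx => h x hx.2 fun s hs => ?_
    exact hx.1 s (Submodule.le_topologicalClosure _ (Submodule.subset_span hs))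
  rw [← Submodule.sup_orthogonal_inf_of_hasOrthogonalProjection closure_le, orthogonal_inf,
    sup_bot_eq]

theorem wavePacketRange_standardGaussian_eq_cauchyRiemannSpace (N : ℕ) {ħ : ℝ} (hħ : 0 < ħ) :
    wavePacketRange ħ hħ (standardGaussian N ħ hħ) = cauchyRiemannSpace N (1 / (4 * ħ)) := by
  have ha : 0 < 1 / (4 * ħ) := by positivity
  have closure_eq_range : (Submodule.span ℂ (Set.range (coherentState ha))).topologicalClosure =
      wavePacketRange ħ hħ (standardGaussian N ħ hħ) :=
    topologicalClosure_span_eq_of_inner_eq_zero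
      (isClosed_wavePacketRange hħ (norm_standardGaussian N hħ))
      (Set.range_subset_iff.2 (coherentState_mem_wavePacketRange hħ)) fun Ψ hΨ h =>
        eq_zero_of_mem_wavePacketRange_of_inner_coherentState_eq_zero hħ hΨ
          (Set.forall_mem_range.1 h)
  have closure_eq_cauchyRiemannSpace :
      (Submodule.span ℂ (Set.range (coherentState ha))).topologicalClosure =
        cauchyRiemannSpace N (1 / (4 * ħ)) :=
    topologicalClosure_span_eq_of_inner_eq_zero (isClosed_cauchyRiemannSpace N _)
      (Set.range_subset_iff.2 (coherentState_mem_cauchyRiemannSpace ha)) fun Ψ hΨ h =>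
        eq_zero_of_mem_cauchyRiemannSpace_of_inner_coherentState_eq_zero ha hΨ
          (Set.forall_mem_range.1 h)
  rw [← closure_eq_range, closure_eq_cauchyRiemannSpace]

theorem prodGaussianExp_neg_zero {E F : Type*} [NormedAddCommGroup E] [NormedSpace ℝ E]
    [NormedAddCommGroup F] [NormedSpace ℝ F] (a : ℝ) (z : E × F) :
    prodGaussianExp (-a) 0 z = (Real.exp (a * (‖z.1‖ ^ 2 + ‖z.2‖ ^ 2)) : ℂ) := by
  simp [prodGaussianExp]

end WavePacket

end

theorem mainTheorem8 (N : ℕ) (ħ : ℝ) (hħ : 0 < ħ) :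
    (∀ Ψ : Lp ℂ 2 (volume : Measure (WavePacket.Phase N)),
      Ψ ∈ WavePacket.wavePacketRange ħ hħ (WavePacket.standardGaussian N ħ hħ) ↔
        ∀ j : Fin N, WavePacket.SatisfiesCauchyRiemann j fun z =>
          (Real.exp ((1 / (4 * ħ)) * (‖z.1‖ ^ 2 + ‖z.2‖ ^ 2)) : ℂ) * Ψ z) ∧
    (∀ φ : 𝓢(WavePacket.Config N, ℂ), ‖φ.toLp 2‖ = 1 →
      Nonempty (WavePacket.wavePacketRange ħ hħ φ ≃ₗᵢ[ℂ]
        WavePacket.wavePacketRange ħ hħ (WavePacket.standardGaussian N ħ hħ))) := by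
  refine ⟨fun Ψ => ?_, fun φ hφ => ?_⟩
  · simp_rw [WavePacket.wavePacketRange_standardGaussian_eq_cauchyRiemannSpace N hħ,
      WavePacket.mem_cauchyRiemannSpace_iff, WavePacket.prodGaussianExp_neg_zero]
  · exact WavePacket.nonempty_wavePacketRange_linearIsometryEquiv hħ hφ
      (WavePacket.norm_standardGaussian N hħ)
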